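/- Let $m_1,m_2$ be natural numbers, $m=m_1+m_2$, $j=\begin{bmatrix}I_{m_1}&0\\0&-I_{m_2}\end{bmatrix}$, $a>0$, $M>0$ and $\mathcal D=\{(x,t):0\le x<\infty,\ 0\le t<a\}$; derivatives at the boundary of $\mathcal D$ are one-sided, $\|\cdot\|$ is the operator norm for the $\ell^2$-norms. Let the $m_1\times m_2$ matrix function $v(x,t)$ be continuously differentiable on $\mathcal D$, let $v_{xx}$ exist on $\mathcal D$, and assume that on $\mathcal D$ $$2v_t+\mathrm i\,(v_{xx}+2vv^*v)=0,\qquad \sup_{(x,t)\in\mathcal D}\|v(x,t)\|\le M,\qquad \sup_{x>0}\|v_x(x,t)\|<\infty\ \text{ for each }0\le t<a .$$ Put $V=\begin{bmatrix}0&v\\v^*&0\end{bmatrix}$, $G=\mathrm i zj+jV$, $F=\mathrm i\big(z^2j-\mathrm i zjV-\tfrac12(V_x+jV^2)\big)$. Let $u(x,t,z)$ be the normalized fundamental solution of the Dirac system $u_x=Gu$, $u(0,t,z)=I_m$ $(x\ge0)$, and $R(t,z)=\{R_{ij}(t,z)\}_{i,j=1}^2$ (with $R_{11}$ of size $m_1\times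 m_1$) that of $R_t(t,z)=F(0,t,z)R(t,z)$, $R(0,z)=I_m$ $(0\le t<a)$. For $\Im z>M$, let $\mathcal N_t(x,z)$ be the set of the values at $z$ of the matrix functions $$\begin{bmatrix}0&I_{m_2}\end{bmatrix}u(x,t,z)^{-1}\mathcal P(z)\Big(\begin{bmatrix}I_{m_1}&0\end{bmatrix}u(x,t,z)^{-1}\mathcal P(z)\Big)^{-1},$$ where $\mathcal P$ runs through the $m\times m_1$ matrix functions that are meromorphic in the open upper half-plane and satisfy $\mathcal P^*\mathcal P>0$, $\mathcal P^*j\mathcal P\ge0$ in the half-plane $\Im z>M$ outside a discrete set of points, and where each $\mathcal P$ is evaluated only at points at which it is analytic and satisfies these two relations. The Weyl function $\varphi(t,z)$, $\Im z>M$, of the Dirac system $y_x=G(x,t,z)y$ is defined by $\bigcap_{0\le x<\infty}\mathcal N_t(x,z)=\{\varphi(t,z)\}$. Then $R$ and, for each $0\le t<a$, the Weyl function $\varphi(t,\cdot)$ exist, and for all $0\le t<a$ and $\Im z>M$ the matrix $R_{11}(t,z)+R_{12}(t,z)\varphi(0,z)$ is invertible and $$\varphi(t,z)=\big(R_{21}(t,z)+R_{22}(t,z)\varphi(0,z)\big)\big(R_{11}(t,z)+R_{12}(t,z)\varphi(0,z)\big)^{-1}.$$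 -/

import Mathlib

open Set Filter Topology Matrix
open scoped Matrix.Norms.L2Operator ComplexOrder

namespace FocusingNLS

variable {m₁ m₂ : ℕ}

/-- The `m × m` matrices, `m = m₁ + m₂`, written with rows and columns split into two blocks. -/
abbrev BlockMat (m₁ m₂ : ℕ) : Type := Matrix (Fin m₁ ⊕ Fin m₂) (Fin m₁ ⊕ Fin m₂) ℂ

/-- The signature matrix `j = diag (I, -I)`. -/
def sigJ (m₁ m₂ : ℕ) : BlockMat m₁ m₂ := fromBlocks 1 0 0 (-1)

/-- The self-adjoint block matrix with off-diagonal blocks `w` and `w*`. -/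
def potBlock (w : Matrix (Fin m₁) (Fin m₂) ℂ) : BlockMat m₁ m₂ := fromBlocks 0 w wᴴ 0

/-- The coefficient `G = i z j + j V` of the skew-self-adjoint Dirac system, at a point where the
potential has the value `w`. -/
noncomputable def coeffG (z : ℂ) (w : Matrix (Fin m₁) (Fin m₂) ℂ) : BlockMat m₁ m₂ :=
  (Complex.I * z) • sigJ m₁ m₂ + sigJ m₁ m₂ * potBlock w

/-- The coefficient `F = i (z² j - i z j V - (V_x + j V²) / 2)` of the second auxiliary system, at
a point where the potential has the value `w` and its `x`-derivative has the value `p`. -/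
noncomputable def coeffF (z : ℂ) (w p : Matrix (Fin m₁) (Fin m₂) ℂ) : BlockMat m₁ m₂ :=
  Complex.I • (z ^ 2 • sigJ m₁ m₂ - (Complex.I * z) • (sigJ m₁ m₂ * potBlock w)
    - (1 / 2 : ℂ) • (potBlock p + sigJ m₁ m₂ * potBlock w ^ 2))

/-- `Y` is the normalized fundamental solution of `Y' = A Y`, `Y 0 = I`, on the interval `s`
(derivatives at end points of `s` that belong to `s` are one-sided). -/
def IsFundamentalSolution (s : Set ℝ) (A Y : ℝ → BlockMat m₁ m₂) : Prop :=
  Y 0 = 1 ∧ ∀ x ∈ s, HasDerivWithinAt Y (A x * Y x) s x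

/-- The two relations `P* P > 0`, `P* j P ≥ 0` for an `m × m₁` matrix. -/
def PropertyJ (P : Matrix (Fin m₁ ⊕ Fin m₂) (Fin m₁) ℂ) : Prop :=
  (Pᴴ * P).PosDef ∧ (Pᴴ * sigJ m₁ m₂ * P).PosSemidef

/-- The class of nonsingular `m × m₁` matrix functions with property-`j`: meromorphic in the open
upper half-plane, with `P(z)* P(z) > 0` and `P(z)* j P(z) ≥ 0` in the half-plane `Im z > M`
outside a set of points that is discrete in this half-plane. -/
def ParamClass (m₁ m₂ : ℕ) (M : ℝ) : Set (ℂ → Matrix (Fin m₁ ⊕ Fin m₂) (Fin m₁) ℂ) :=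
  {P | (∀ i k, MeromorphicOn (fun z => P z i k) {z : ℂ | 0 < z.im}) ∧
    ∀ᶠ z in codiscreteWithin {z : ℂ | M < z.im}, PropertyJ (P z)}

/-- The set `𝒩(x, z)` of the Dirac system on `[0, ∞)` with potential `q`: the values at `(x, z)` of
`[0 I] u(x,z)⁻¹ P(z) ([I 0] u(x,z)⁻¹ P(z))⁻¹`, where `u` is the normalized fundamental solution and
`P` runs through the parameter class. The parameters are evaluated at their non-exceptional
points only, that is, where `P` is analytic and satisfies the two relations. -/
def mobiusSet (M : ℝ) (q : ℝ → Matrix (Fin m₁) (Fin m₂) ℂ) (x : ℝ) (z : ℂ) :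
    Set (Matrix (Fin m₂) (Fin m₁) ℂ) :=
  {w | ∃ u : ℝ → BlockMat m₁ m₂, ∃ P ∈ ParamClass m₁ m₂ M,
    IsFundamentalSolution (Ici 0) (fun s => coeffG z (q s)) u ∧
    (∀ i k, AnalyticAt ℂ (fun ζ => P ζ i k) z) ∧ PropertyJ (P z) ∧
    w = toRows₂ ((u x)⁻¹ * P z) * (toRows₁ ((u x)⁻¹ * P z))⁻¹}

/-- `φ` is the Weyl function, in the half-plane `Im z > M`, of the Dirac system on `[0, ∞)` with
potential `q` bounded by `M`: `φ(z)` is the one and only common element of all `𝒩(x, z)`. -/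
def IsWeylFunction (M : ℝ) (q : ℝ → Matrix (Fin m₁) (Fin m₂) ℂ)
    (φ : ℂ → Matrix (Fin m₂) (Fin m₁) ℂ) : Prop :=
  ∀ z : ℂ, M < z.im → ⋂ x ∈ Ici (0 : ℝ), mobiusSet M q x z = {φ z}

/-- The semi-strip `{(x, t) : 0 ≤ x < ∞, 0 ≤ t < a}`. -/
def semiStrip (a : ℝ) : Set (ℝ × ℝ) := Ici 0 ×ˢ Ico 0 a

/-- The partial derivative in `x` on the semi-strip (one-sided at `x = 0`). -/
noncomputable def partialX (v : ℝ → ℝ → Matrix (Fin m₁) (Fin m₂) ℂ) (x t : ℝ) :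
    Matrix (Fin m₁) (Fin m₂) ℂ :=
  derivWithin (fun s => v s t) (Ici 0) x

/-- The partial derivative in `t` on the semi-strip (one-sided at `t = 0`). -/
noncomputable def partialT (a : ℝ) (v : ℝ → ℝ → Matrix (Fin m₁) (Fin m₂) ℂ) (x t : ℝ) :
    Matrix (Fin m₁) (Fin m₂) ℂ :=
  derivWithin (fun s => v x s) (Ico 0 a) t

end FocusingNLS

/-! The equation for `v` is the zero curvature condition `G_t - F_x + GF - FG = 0`
(`zero_curvature`). If `R(x,t)` denotes the normalized solution of `R_t = F(x,t)R`, this yields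
`R(x,t) u(x,0) = u(x,t) R(0,t)` (`fundamentalSolution_factorization`).

For `Im z > M` the form of `j` decreases along solutions of the Dirac system, at least at the rate
`2(Im z - M)` times the squared length (`reForm_coeffG_le`). Hence `𝒩(x,z)` consists of those `w`
for which `u(x)` maps the graph of `w` to vectors of nonnegative `j`-form (`mem_mobiusSet_iff`).
These sets are nested, compact and nonempty, and two common elements would make the energy fall
below zero (`eq_of_forall_isJNonneg`). So the Weyl function exists, and `φ(z)` is the only `w` whose
graph stays `j`-nonnegative for all `x` (`IsWeylFunction.eq_iff`).

It remains to see that `R(0,t)` carries the graph of `φ(0,z)` to a graph that stays `j`-nonnegative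
under `u(x,t)`. For `g` in the graph of `φ(0,z)`, the length of `u(y,0)g` is arbitrarily small at
arbitrarily large `y` (`exists_lenSq_le`). The Hermitian part of `F` does not contain `v_x`, so
`R(y,t)` is bounded uniformly in `y` (`exists_lenSq_coeffF_le`). By the factorization `u(y,t)R(0,t)g
= R(y,t)u(y,0)g` is small as well, so its `j`-form is at least `-ε`; by monotonicity in `y` the same
bound holds at every earlier point. -/

namespace FocusingNLS

/-! ### Linear differential equations: existence, uniqueness, dependence on a parameter. -/

section LinearODE

variable {𝔸 : Type*} [NormedRing 𝔸] [NormedAlgebra ℝ 𝔸]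

/-- Global existence for `Y' = A Y`, `Y 0 = 1`, by contraction in a weighted supremum norm. -/
theorem exists_linearODE_of_continuous [CompleteSpace 𝔸] (A : ℝ → 𝔸) (hA : Continuous A) :
    ∃ Y : ℝ → 𝔸, Y 0 = 1 ∧ ∀ t, 0 ≤ t → HasDerivAt Y (A t * Y t) t := by
  -- The factor 2 in the weight `exp (-L)` makes the integral operator a contraction with constant
  -- `1/2`, however large `A` is.
  set L : ℝ → ℝ := fun t => 2 * ∫ s in (0 : ℝ)..t, ‖A s‖ with hL
  have hLd : ∀ t, HasDerivAt L (2 * ‖A t‖) t := fun t =>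
    (intervalIntegral.integral_hasDerivAt_right (hA.norm.intervalIntegrable _ _)
      (hA.norm.stronglyMeasurableAtFilter _ _) hA.norm.continuousAt).const_mul 2
  have hLc : Continuous L := continuous_iff_continuousAt.2 fun t => (hLd t).continuousAt
  have hL0 : L 0 = 0 := by simp [hL]
  have hLe : Continuous fun s => Real.exp (L s) := Real.continuous_exp.comp hLc
  have hweight : ∀ T, 0 ≤ T →
      ∫ s in (0 : ℝ)..T, Real.exp (L s) * ‖A s‖ = (Real.exp (L T) - 1) / 2 := by
    intro T _
    have h := intervalIntegral.integral_eq_sub_of_hasDerivAt (a := 0) (b := T)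
      (f := fun s => Real.exp (L s) / 2) (f' := fun s => Real.exp (L s) * ‖A s‖)
      (fun x _ => (((hLd x).exp).div_const 2).congr_deriv (by ring))
      ((hLe.mul hA.norm).intervalIntegrable _ _)
    rw [h, hL0, Real.exp_zero]
    ring
  have hint : ∀ w : ℝ → 𝔸, Continuous w → ∀ t,
      HasDerivAt (fun t => ∫ s in (0 : ℝ)..t, Real.exp (L s) • (A s * w s))
        (Real.exp (L t) • (A t * w t)) t := by
    intro w hw t
    have hc : Continuous fun s => Real.exp (L s) • (A s * w s) := hLe.smul (hA.mul hw)
    exact intervalIntegral.integral_hasDerivAt_right (hc.intervalIntegrable _ _)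
      (hc.stronglyMeasurableAtFilter _ _) hc.continuousAt
  have hbd : ∀ (w : ℝ → 𝔸) (C : ℝ), Continuous w → (∀ s, ‖w s‖ ≤ C) → ∀ T, 0 ≤ T →
      ‖∫ s in (0 : ℝ)..T, Real.exp (L s) • (A s * w s)‖ ≤ C * ((Real.exp (L T) - 1) / 2) := by
    intro w C hw hC T hT
    rw [← hweight T hT, ← intervalIntegral.integral_const_mul]
    refine intervalIntegral.norm_integral_le_of_norm_le hT ?_
      ((continuous_const.mul (hLe.mul hA.norm)).intervalIntegrable _ _)
    refine Eventually.of_forall fun s _ => ?_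
    rw [norm_smul, Real.norm_eq_abs, abs_of_pos (Real.exp_pos _)]
    calc Real.exp (L s) * ‖A s * w s‖ ≤ Real.exp (L s) * (‖A s‖ * C) := by
          gcongr
          exact (norm_mul_le _ _).trans (by gcongr; exact hC s)
      _ = C * (Real.exp (L s) * ‖A s‖) := by ring
  have hLnn : ∀ T, 0 ≤ T → 0 ≤ L T := fun T hT =>
    mul_nonneg two_pos.le (intervalIntegral.integral_nonneg hT fun s _ => norm_nonneg _)
  have hexp : ∀ T, Real.exp (-L T) * Real.exp (L T) = 1 := fun T => by
    rw [← Real.exp_add]; simp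
  have hexp1 : ∀ T, 0 ≤ T → Real.exp (-L T) ≤ 1 := fun T hT =>
    Real.exp_le_one_iff.2 (by linarith [hLnn T hT])
  -- The unknown is `w = exp (-L) • Y`, which is bounded on the half-line; clamping `t` at 0 extends
  -- it to all of `ℝ`.
  let Φ : BoundedContinuousFunction ℝ 𝔸 → BoundedContinuousFunction ℝ 𝔸 := fun w =>
    BoundedContinuousFunction.ofNormedAddCommGroup
      (fun t => Real.exp (-L (max t 0)) •
        (1 + ∫ s in (0 : ℝ)..(max t 0), Real.exp (L s) • (A s * w s)))
      (by
        have h1 : Continuous fun t => ∫ s in (0 : ℝ)..t, Real.exp (L s) • (A s * w s) :=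
          continuous_iff_continuousAt.2 fun t => (hint w w.continuous t).continuousAt
        have h2 : Continuous fun t : ℝ => max t 0 := continuous_id.max continuous_const
        exact (Real.continuous_exp.comp (hLc.comp h2).neg).smul
          (continuous_const.add (h1.comp h2)))
      (‖(1 : 𝔸)‖ + ‖w‖)
      (by
        intro t
        have hT : 0 ≤ max t 0 := le_max_right _ _
        have hw := hbd w ‖w‖ w.continuous (fun s => w.norm_coe_le_norm s) _ hT
        rw [norm_smul, Real.norm_eq_abs, abs_of_pos (Real.exp_pos _)]
        have h3 := hexp (max t 0)
        have h4 := hexp1 _ hT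
        have h5 := Real.exp_pos (-L (max t 0))
        have h6 := norm_add_le (1 : 𝔸) (∫ s in (0 : ℝ)..(max t 0), Real.exp (L s) • (A s * w s))
        calc _ ≤ Real.exp (-L (max t 0)) *
              (‖(1 : 𝔸)‖ + ‖w‖ * ((Real.exp (L (max t 0)) - 1) / 2)) := by
              gcongr; exact h6.trans (by gcongr)
          _ = Real.exp (-L (max t 0)) * ‖(1 : 𝔸)‖ + ‖w‖ / 2 *
              (Real.exp (-L (max t 0)) * Real.exp (L (max t 0)) - Real.exp (-L (max t 0))) := by
              ring
          _ ≤ 1 * ‖(1 : 𝔸)‖ + ‖w‖ / 2 * (1 - 0) := by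
              rw [h3]; gcongr
          _ ≤ _ := by linarith [norm_nonneg w])
  have hΦ : ∀ w t, Φ w t = Real.exp (-L (max t 0)) •
        (1 + ∫ s in (0 : ℝ)..(max t 0), Real.exp (L s) • (A s * w s)) := fun w t => rfl
  have hcontr : ContractingWith (1 / 2 : NNReal) Φ := by
    refine ⟨by
      rw [← NNReal.coe_lt_coe]; norm_num, LipschitzWith.of_dist_le_mul fun w₁ w₂ => ?_⟩
    rw [BoundedContinuousFunction.dist_le (by positivity)]
    intro t
    have hT : 0 ≤ max t 0 := le_max_right _ _
    have hii : ∀ w : BoundedContinuousFunction ℝ 𝔸, IntervalIntegrable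
        (fun s => Real.exp (L s) • (A s * w s)) MeasureTheory.volume 0 (max t 0) := fun w =>
      (hLe.smul (hA.mul w.continuous)).intervalIntegrable _ _
    have hsub : Φ w₁ t - Φ w₂ t = Real.exp (-L (max t 0)) •
        ∫ s in (0 : ℝ)..(max t 0), Real.exp (L s) • (A s * (w₁ s - w₂ s)) := by
      rw [hΦ, hΦ, ← smul_sub, add_sub_add_left_eq_sub, ← intervalIntegral.integral_sub
        (hii w₁) (hii w₂)]
      simp only [mul_sub, smul_sub]
    have hw := hbd (fun s => w₁ s - w₂ s) (dist w₁ w₂) (w₁.continuous.sub w₂.continuous)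
      (fun s => by rw [← dist_eq_norm]; exact BoundedContinuousFunction.dist_coe_le_dist s) _ hT
    rw [dist_eq_norm, hsub, norm_smul, Real.norm_eq_abs, abs_of_pos (Real.exp_pos _)]
    have h3 := hexp (max t 0)
    have h5 := Real.exp_pos (-L (max t 0))
    calc _ ≤ Real.exp (-L (max t 0)) *
          (dist w₁ w₂ * ((Real.exp (L (max t 0)) - 1) / 2)) := by gcongr
      _ = dist w₁ w₂ / 2 * (Real.exp (-L (max t 0)) * Real.exp (L (max t 0))
            - Real.exp (-L (max t 0))) := by ring
      _ ≤ dist w₁ w₂ / 2 * (1 - 0) := by rw [h3]; gcongr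
      _ = _ := by push_cast; ring
  set w := ContractingWith.fixedPoint Φ hcontr with hw
  have hfix : Φ w = w := hcontr.fixedPoint_isFixedPt
  refine ⟨fun t => 1 + ∫ s in (0 : ℝ)..t, Real.exp (L s) • (A s * w s), by simp, ?_⟩
  intro t ht
  have hwt : w t = Real.exp (-L t) • (1 + ∫ s in (0 : ℝ)..t, Real.exp (L s) • (A s * w s)) := by
    have := hΦ w t
    rwa [hfix, max_eq_left ht] at this
  have h := (hint w w.continuous t).const_add 1
  refine h.congr_deriv ?_
  rw [hwt, mul_smul_comm, smul_smul, mul_comm (Real.exp _), hexp, one_smul]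

theorem norm_le_gronwall_of_hasDerivWithinAt {E : Type*} [NormedAddCommGroup E] [NormedSpace ℝ E]
    {T K ε : ℝ} {f f' : ℝ → E} (hf : ∀ t ∈ Icc 0 T, HasDerivWithinAt f (f' t) (Icc 0 T) t)
    (h0 : f 0 = 0) (hb : ∀ t ∈ Icc 0 T, ‖f' t‖ ≤ K * ‖f t‖ + ε) :
    ∀ t ∈ Icc 0 T, ‖f t‖ ≤ gronwallBound 0 K ε t := by
  intro t ht
  have := norm_le_gronwallBound_of_norm_deriv_right_le (f := f) (f' := f') (δ := 0) (K := K)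
    (ε := ε) (a := 0) (b := T) (fun t ht => (hf t ht).continuousWithinAt)
    (fun t ht => (hf t (Ico_subset_Icc_self ht)).mono_of_mem_nhdsWithin
      (Icc_mem_nhdsGE_of_mem ht)) (by simp [h0]) (fun t ht => hb t (Ico_subset_Icc_self ht)) t ht
  simpa using this

theorem exists_bound_of_continuousOn_Icc {E : Type*} [NormedAddCommGroup E] {T : ℝ} {A : ℝ → E}
    (hA : ContinuousOn A (Icc 0 T)) : ∃ K, 0 ≤ K ∧ ∀ t ∈ Icc 0 T, ‖A t‖ ≤ K := by
  obtain ⟨K, hK⟩ := isCompact_Icc.exists_bound_of_continuousOn hA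
  exact ⟨max K 0, le_max_right _ _, fun t ht => (hK t ht).trans (le_max_left _ _)⟩

theorem linearODE_unique {T : ℝ} {A Y Z : ℝ → 𝔸} (hA : ContinuousOn A (Icc 0 T))
    (hY : ∀ t ∈ Icc 0 T, HasDerivWithinAt Y (A t * Y t) (Icc 0 T) t)
    (hZ : ∀ t ∈ Icc 0 T, HasDerivWithinAt Z (A t * Z t) (Icc 0 T) t) (h0 : Y 0 = Z 0) :
    ∀ t ∈ Icc 0 T, Y t = Z t := by
  obtain ⟨K, hK0, hK⟩ := exists_bound_of_continuousOn_Icc hA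
  intro t ht
  have := norm_le_gronwall_of_hasDerivWithinAt (f := fun t => Y t - Z t) (T := T) (K := K)
    (ε := 0) (fun t ht => (hY t ht).sub (hZ t ht)) (by simp [h0]) (fun t ht => by
      rw [← mul_sub, add_zero]
      exact (norm_mul_le _ _).trans (by gcongr; exact hK t ht)) t ht
  rw [gronwallBound_ε0_δ0] at this
  exact sub_eq_zero.1 (norm_le_zero_iff.1 this)

theorem exists_linearODE_Ici [CompleteSpace 𝔸] {A : ℝ → 𝔸} (hA : ContinuousOn A (Ici 0)) :
    ∃ Y : ℝ → 𝔸, Y 0 = 1 ∧ ∀ t ∈ Ici (0 : ℝ), HasDerivWithinAt Y (A t * Y t) (Ici 0) t := by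
  obtain ⟨Y, hY0, hY⟩ := exists_linearODE_of_continuous (fun t => A (max t 0))
    (hA.comp_continuous (continuous_id.max continuous_const) fun t => mem_Ici.2 (le_max_right _ _))
  refine ⟨Y, hY0, fun t ht => ?_⟩
  have := (hY t ht).hasDerivWithinAt (s := Ici 0)
  rwa [max_eq_left (mem_Ici.1 ht)] at this

theorem exists_linearODE_Ico [CompleteSpace 𝔸] {a : ℝ} (ha : 0 < a) {A : ℝ → 𝔸}
    (hA : ContinuousOn A (Ico 0 a)) :
    ∃ Y : ℝ → 𝔸, Y 0 = 1 ∧ ∀ t ∈ Ico 0 a, HasDerivWithinAt Y (A t * Y t) (Ico 0 a) t := by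
  have h : ∀ T ∈ Ico 0 a, ∃ Y : ℝ → 𝔸, Y 0 = 1 ∧
      ∀ t ∈ Icc 0 T, HasDerivAt Y (A t * Y t) t := by
    intro T hT
    obtain ⟨Y, hY0, hY⟩ := exists_linearODE_of_continuous (fun t => A (max 0 (min T t)))
      (hA.comp_continuous (continuous_const.max (continuous_const.min continuous_id)) fun t =>
        ⟨le_max_left _ _, max_lt (hT.1.trans_lt hT.2) ((min_le_left _ _).trans_lt hT.2)⟩)
    refine ⟨Y, hY0, fun t ht => ?_⟩
    have := hY t ht.1
    rwa [min_eq_right ht.2, max_eq_right ht.1] at this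
  choose! W hW0 hW using h
  -- The value at `t` is read off from the solution on `[0, (t + a) / 2]`. That interval reaches
  -- beyond `t`, so a single solution represents the glued function near `t` from the right as well.
  have hmid : ∀ t ∈ Ico 0 a, t < (t + a) / 2 ∧ (t + a) / 2 ∈ Ico 0 a := fun t ht =>
    ⟨by linarith [ht.2], by linarith [ht.1, ht.2], by linarith [ht.2]⟩
  have hWW : ∀ T ∈ Ico 0 a, ∀ t ∈ Icc 0 T, W T t = W ((t + a) / 2) t := by
    intro T hT t ht
    have hta : t ∈ Ico 0 a := ⟨ht.1, ht.2.trans_lt hT.2⟩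
    refine linearODE_unique (T := t) (A := A)
      (hA.mono fun s hs => ⟨hs.1, hs.2.trans_lt hta.2⟩)
      (fun s hs => (hW T hT s ⟨hs.1, hs.2.trans ht.2⟩).hasDerivWithinAt)
      (fun s hs => (hW _ (hmid t hta).2 s
        ⟨hs.1, hs.2.trans (hmid t hta).1.le⟩).hasDerivWithinAt)
      (by rw [hW0 T hT, hW0 _ (hmid t hta).2]) t ⟨ht.1, le_rfl⟩
  refine ⟨fun t => W ((t + a) / 2) t, ?_, fun t ht => ?_⟩
  · exact hW0 _ (hmid 0 ⟨le_rfl, ha⟩).2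
  · have hm := hmid t ht
    refine ((hW _ hm.2 t ⟨ht.1, hm.1.le⟩).hasDerivWithinAt).congr_of_eventuallyEq ?_ rfl
    filter_upwards [self_mem_nhdsWithin, mem_nhdsWithin_of_mem_nhds (Iio_mem_nhds hm.1)]
      with s hs hs'
    exact (hWW _ hm.2 s ⟨hs.1, le_of_lt hs'⟩).symm

/-- Differentiability in a parameter of the normalized solution of a linear equation. -/
theorem hasDerivWithinAt_param_linearODE {T x₀ : ℝ} (hT : 0 ≤ T) {s : Set ℝ} (hx₀ : x₀ ∈ s)
    {A R : ℝ → ℝ → 𝔸} {B Q : ℝ → 𝔸}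
    (hA : ContinuousOn (A x₀) (Icc 0 T)) (hB : ContinuousOn B (Icc 0 T))
    (hAB : ∀ ε > 0, ∀ᶠ x in 𝓝[s] x₀, ∀ t ∈ Icc 0 T,
      ‖A x t - A x₀ t - (x - x₀) • B t‖ ≤ ε * |x - x₀|)
    (hR : ∀ x ∈ s, ∀ t ∈ Icc 0 T, HasDerivWithinAt (R x) (A x t * R x t) (Icc 0 T) t)
    (hR0 : ∀ x ∈ s, R x 0 = 1)
    (hQ : ∀ t ∈ Icc 0 T, HasDerivWithinAt Q (A x₀ t * Q t + B t * R x₀ t) (Icc 0 T) t)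
    (hQ0 : Q 0 = 0) :
    HasDerivWithinAt (fun x => R x T) (Q T) s x₀ := by
  obtain ⟨KA, hKA0, hKA⟩ := exists_bound_of_continuousOn_Icc hA
  obtain ⟨KB, hKB0, hKB⟩ := exists_bound_of_continuousOn_Icc hB
  obtain ⟨KR, hKR0, hKR⟩ := exists_bound_of_continuousOn_Icc
    (fun t ht => (hR x₀ hx₀ t ht).continuousWithinAt)
  obtain ⟨KQ, hKQ0, hKQ⟩ := exists_bound_of_continuousOn_Icc
    (fun t ht => (hQ t ht).continuousWithinAt)
  -- `K` bounds `A x` for `x` near `x₀`, and `ε * |x - x₀| * N` bounds the inhomogeneity in the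
  -- equation of the remainder; the summand 1 in `N` keeps it positive.
  set K := KA + KB + 1 with hK
  have hK1 : 1 ≤ K := by rw [hK]; linarith
  set N := KR + (KB + 1) * KQ + 1 with hN
  have hN1 : 0 < N := by
    rw [hN]; positivity
  set g := gronwallBound 0 K N T with hg
  have hlin : ∀ ε, gronwallBound 0 K (ε * N) T = ε * g := by
    intro ε
    rw [hg, gronwallBound_of_K_ne_0 (by positivity), gronwallBound_of_K_ne_0 (by positivity)]
    ring
  have hg0 : 0 ≤ g := by
    have := gronwallBound_mono (δ := 0) (ε := N) (K := K) le_rfl hN1.le (by positivity) hT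
    rwa [gronwallBound_x0] at this
  rw [hasDerivWithinAt_iff_isLittleO, Asymptotics.isLittleO_iff]
  intro c hc
  -- The Gronwall bound is linear in the inhomogeneity, so the remainder is at most `ε * g * |x -
  -- x₀|`. The same `ε` limits `|x - x₀|`, which absorbs the quadratic term.
  set ε := min 1 (c / (g + 1)) with hε
  have hε0 : 0 < ε := lt_min one_pos (by positivity)
  have hεg : ε * g ≤ c := by
    calc ε * g ≤ c / (g + 1) * (g + 1) := by
          gcongr
          · exact min_le_right _ _
          · linarith
      _ = c := by field_simp
  filter_upwards [hAB ε hε0, self_mem_nhdsWithin,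
    mem_nhdsWithin_of_mem_nhds (Metric.ball_mem_nhds x₀ hε0)] with x hx hxs hxb
  have hxb' : |x - x₀| ≤ ε := by
    have := Metric.mem_ball.1 hxb
    rw [Real.dist_eq] at this; exact this.le
  have hxb1 : |x - x₀| ≤ 1 := hxb'.trans (min_le_left _ _)
  set h := |x - x₀| with hh
  have hh0 : 0 ≤ h := abs_nonneg _
  have hdiff : ∀ t ∈ Icc 0 T, ‖A x t - A x₀ t‖ ≤ h * (KB + 1) := by
    intro t ht
    calc ‖A x t - A x₀ t‖ = ‖(A x t - A x₀ t - (x - x₀) • B t) + (x - x₀) • B t‖ := by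
          congr 1; abel
      _ ≤ ε * h + h * KB := by
          refine (norm_add_le _ _).trans (add_le_add (hx t ht) ?_)
          rw [norm_smul, Real.norm_eq_abs]
          gcongr; exact hKB t ht
      _ ≤ 1 * h + h * KB := by gcongr; exact min_le_left _ _
      _ = _ := by ring
  have hmain := norm_le_gronwall_of_hasDerivWithinAt (T := T) (K := K) (ε := (ε * h) * N)
    (f := fun t => R x t - R x₀ t - (x - x₀) • Q t)
    (f' := fun t => A x t * R x t - A x₀ t * R x₀ t
      - (x - x₀) • (A x₀ t * Q t + B t * R x₀ t))
    (fun t ht => ((hR x hxs t ht).sub (hR x₀ hx₀ t ht)).sub ((hQ t ht).const_smul (x - x₀)))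
    (by simp [hR0 x hxs, hR0 x₀ hx₀, hQ0]) (fun t ht => by
      -- The remainder satisfies the linear equation with coefficient `A x`, up to two terms of
      -- order `o(|x - x₀|)`.
      have e : A x t * R x t - A x₀ t * R x₀ t - (x - x₀) • (A x₀ t * Q t + B t * R x₀ t)
          = A x t * (R x t - R x₀ t - (x - x₀) • Q t)
            + ((A x t - A x₀ t - (x - x₀) • B t) * R x₀ t
              + (A x t - A x₀ t) * ((x - x₀) • Q t)) := by
        simp only [mul_sub, sub_mul, smul_add, mul_smul_comm, smul_mul_assoc, smul_sub]
        abel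
      rw [e]
      refine (norm_add_le _ _).trans (add_le_add ?_ ?_)
      · refine (norm_mul_le _ _).trans ?_
        gcongr
        calc ‖A x t‖ = ‖A x₀ t + (A x t - A x₀ t)‖ := by congr 1; abel
          _ ≤ KA + h * (KB + 1) := (norm_add_le _ _).trans (add_le_add (hKA t ht) (hdiff t ht))
          _ ≤ KA + 1 * (KB + 1) := by gcongr
          _ = K := by rw [hK]; ring
      · calc _ ≤ (ε * h) * KR + (h * (KB + 1)) * (h * KQ) := by
              refine (norm_add_le _ _).trans (add_le_add ?_ ?_)
              · refine (norm_mul_le _ _).trans ?_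
                gcongr
                · exact hx t ht
                · exact hKR t ht
              · refine (norm_mul_le _ _).trans ?_
                rw [norm_smul, Real.norm_eq_abs]
                gcongr
                · exact hdiff t ht
                · exact hKQ t ht
          _ ≤ (ε * h) * KR + (h * (KB + 1)) * (ε * KQ) := by gcongr
          _ = (ε * h) * (KR + (KB + 1) * KQ) := by ring
          _ ≤ _ := by
              gcongr
              rw [hN]; linarith) T ⟨hT, le_rfl⟩
  rw [hlin] at hmain
  refine hmain.trans ?_
  rw [Real.norm_eq_abs]
  calc ε * h * g = (ε * g) * h := by ring
    _ ≤ c * h := by gcongr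

/-- A function with continuous partial derivative is differentiable uniformly over compact sets of
the other variable. -/
theorem eventually_forall_norm_sub_sub_le {E : Type*} [NormedAddCommGroup E] [NormedSpace ℝ E]
    {T x₀ : ℝ} (hx₀ : 0 ≤ x₀) {A B : ℝ → ℝ → E}
    (hB : ContinuousOn (fun p : ℝ × ℝ => B p.1 p.2) (Ici 0 ×ˢ Icc 0 T))
    (hAB : ∀ x ∈ Ici (0 : ℝ), ∀ t ∈ Icc 0 T,
      HasDerivWithinAt (fun y => A y t) (B x t) (Ici 0) x) {ε : ℝ} (hε : 0 < ε) :
    ∀ᶠ x in 𝓝[Ici 0] x₀, ∀ t ∈ Icc 0 T,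
      ‖A x t - A x₀ t - (x - x₀) • B x₀ t‖ ≤ ε * |x - x₀| := by
  have hcpt : IsCompact (Icc 0 (x₀ + 1) ×ˢ Icc 0 T) := isCompact_Icc.prod isCompact_Icc
  have huc := hcpt.uniformContinuousOn_of_continuous
    (hB.mono (prod_mono Icc_subset_Ici_self le_rfl))
  rw [Metric.uniformContinuousOn_iff] at huc
  obtain ⟨δ, hδ, huc⟩ := huc ε hε
  filter_upwards [self_mem_nhdsWithin, mem_nhdsWithin_of_mem_nhds
    (Metric.ball_mem_nhds x₀ (lt_min hδ one_pos))] with x hx hxb t ht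
  have hconv : Convex ℝ (Ici 0 ∩ Metric.ball x₀ (min δ 1)) :=
    (convex_Ici 0).inter (convex_ball _ _)
  -- Mean value inequality for `A` minus its linear part; uniform continuity of `B` on a compact
  -- rectangle makes the derivative small with one `δ` for all `t`.
  have h := hconv.norm_image_sub_le_of_norm_hasDerivWithin_le
    (f := fun y => A y t - (y - x₀) • B x₀ t) (f' := fun y => B y t - (1 : ℝ) • B x₀ t) (C := ε)
    (x := x₀) (y := x)
    (fun y hy => ((hAB y hy.1 t ht).mono inter_subset_left).sub
      (((hasDerivWithinAt_id _ _).sub_const x₀).smul_const _))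
    (fun y hy => by
      have hd := Metric.mem_ball.1 hy.2
      have hd1 : y ≤ x₀ + 1 := by
        have := (abs_lt.1 (Real.dist_eq y x₀ ▸ hd.trans_le (min_le_right _ _))).2
        linarith
      rw [one_smul, ← dist_eq_norm]
      refine (huc (y, t) ⟨⟨hy.1, hd1⟩, ht⟩ (x₀, t) ⟨⟨hx₀, by simp⟩, ht⟩ ?_).le
      rw [Prod.dist_eq]
      simpa using hd.trans_le (min_le_left _ _))
    ⟨hx₀, Metric.mem_ball_self (lt_min hδ one_pos)⟩ ⟨hx, hxb⟩
  rw [Real.norm_eq_abs] at h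
  refine le_trans (le_of_eq ?_) h
  congr 1
  simp
  abel

end LinearODE

/-! ### The coefficients `G` and `F`, and the zero curvature identity. -/

variable {m₁ m₂ : ℕ}

theorem sigJ_mul_self : sigJ m₁ m₂ * sigJ m₁ m₂ = 1 := by
  simp [sigJ, fromBlocks_multiply, ← fromBlocks_one]

theorem sigJ_conjTranspose : (sigJ m₁ m₂)ᴴ = sigJ m₁ m₂ := by
  simp [sigJ, fromBlocks_conjTranspose]

theorem potBlock_mul_sigJ (w : Matrix (Fin m₁) (Fin m₂) ℂ) :
    potBlock w * sigJ m₁ m₂ = -(sigJ m₁ m₂ * potBlock w) := by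
  simp [sigJ, potBlock, fromBlocks_multiply, fromBlocks_neg]

theorem potBlock_conjTranspose (w : Matrix (Fin m₁) (Fin m₂) ℂ) :
    (potBlock w)ᴴ = potBlock w := by
  simp [potBlock, fromBlocks_conjTranspose]

/-- `potBlock` as a continuous real-linear map. -/
noncomputable def potBlockL (m₁ m₂ : ℕ) : Matrix (Fin m₁) (Fin m₂) ℂ →L[ℝ] BlockMat m₁ m₂ :=
  LinearMap.toContinuousLinearMap
    { toFun := potBlock
      map_add' := fun w w' => by simp [potBlock, fromBlocks_add]
      map_smul' := fun c w => by simp [potBlock, fromBlocks_smul] }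

theorem HasDerivWithinAt.potBlock {f : ℝ → Matrix (Fin m₁) (Fin m₂) ℂ}
    {f' : Matrix (Fin m₁) (Fin m₂) ℂ} {s : Set ℝ} {x : ℝ} (h : HasDerivWithinAt f f' s x) :
    HasDerivWithinAt (fun y => potBlock (f y)) (potBlock f') s x :=
  (potBlockL m₁ m₂).hasFDerivAt.comp_hasDerivWithinAt x h

theorem ContinuousOn.potBlock {X : Type*} [TopologicalSpace X]
    {f : X → Matrix (Fin m₁) (Fin m₂) ℂ} {s : Set X} (h : ContinuousOn f s) :
    ContinuousOn (fun y => potBlock (f y)) s :=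
  (potBlockL m₁ m₂).continuous.comp_continuousOn h

theorem continuousOn_coeffG {q : ℝ → Matrix (Fin m₁) (Fin m₂) ℂ} {s : Set ℝ} (z : ℂ)
    (hq : ContinuousOn q s) : ContinuousOn (fun x => coeffG z (q x)) s :=
  continuousOn_const.add (continuousOn_const.mul (ContinuousOn.potBlock hq))

theorem continuousOn_coeffF {X : Type*} [TopologicalSpace X]
    {q p : X → Matrix (Fin m₁) (Fin m₂) ℂ} {s : Set X} (z : ℂ)
    (hq : ContinuousOn q s) (hp : ContinuousOn p s) :
    ContinuousOn (fun x => coeffF z (q x) (p x)) s :=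
  (((continuousOn_const.sub ((continuousOn_const.mul (ContinuousOn.potBlock hq)).const_smul
    (Complex.I * z))).sub (((ContinuousOn.potBlock hp).add
    (continuousOn_const.mul ((ContinuousOn.potBlock hq).pow 2))).const_smul (1 / 2 : ℂ))).const_smul
    Complex.I)

/-- The `x`-derivative of `coeffF`, where the potential and its first two `x`-derivatives have the
values `w`, `p` and `r`. -/
noncomputable def coeffFDeriv (z : ℂ) (w p r : Matrix (Fin m₁) (Fin m₂) ℂ) : BlockMat m₁ m₂ :=
  Complex.I • (-((Complex.I * z) • (sigJ m₁ m₂ * potBlock p))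
    - (1 / 2 : ℂ) • (potBlock r
      + sigJ m₁ m₂ * (potBlock p * potBlock w + potBlock w * potBlock p)))

theorem continuousOn_coeffFDeriv {X : Type*} [TopologicalSpace X]
    {q p r : X → Matrix (Fin m₁) (Fin m₂) ℂ} {s : Set X} (z : ℂ)
    (hq : ContinuousOn q s) (hp : ContinuousOn p s) (hr : ContinuousOn r s) :
    ContinuousOn (fun x => coeffFDeriv z (q x) (p x) (r x)) s :=
  ((((continuousOn_const.mul (ContinuousOn.potBlock hp)).const_smul
    (Complex.I * z)).neg.sub (((ContinuousOn.potBlock hr).add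
    (continuousOn_const.mul (((ContinuousOn.potBlock hp).mul (ContinuousOn.potBlock hq)).add
      ((ContinuousOn.potBlock hq).mul (ContinuousOn.potBlock hp))))).const_smul
        (1 / 2 : ℂ))).const_smul Complex.I)

theorem hasDerivWithinAt_coeffF {q p : ℝ → Matrix (Fin m₁) (Fin m₂) ℂ}
    {r : Matrix (Fin m₁) (Fin m₂) ℂ} {s : Set ℝ} {x : ℝ} (z : ℂ)
    (hq : HasDerivWithinAt q (p x) s x) (hp : HasDerivWithinAt p r s x) :
    HasDerivWithinAt (fun y => coeffF z (q y) (p y)) (coeffFDeriv z (q x) (p x) r) s x := by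
  have hV := HasDerivWithinAt.potBlock hq
  have hW := HasDerivWithinAt.potBlock hp
  have h := ((((hV.const_mul (sigJ m₁ m₂)).const_smul (Complex.I * z)).const_sub
    (z ^ 2 • sigJ m₁ m₂)).sub ((hW.add ((hV.mul hV).const_mul (sigJ m₁ m₂))).const_smul
      (1 / 2 : ℂ))).const_smul Complex.I
  refine (h.congr_deriv ?_).congr (fun y _ => ?_) ?_
  · rfl
  · simp [coeffF, sq]
  · simp [coeffF, sq]

theorem hasDerivWithinAt_coeffG {q : ℝ → Matrix (Fin m₁) (Fin m₂) ℂ}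
    {p : Matrix (Fin m₁) (Fin m₂) ℂ} {s : Set ℝ} {x : ℝ} (z : ℂ)
    (hq : HasDerivWithinAt q p s x) :
    HasDerivWithinAt (fun y => coeffG z (q y)) (sigJ m₁ m₂ * potBlock p) s x :=
  ((HasDerivWithinAt.potBlock hq).const_mul (sigJ m₁ m₂)).const_add _

/-- Only `J² = 1` and the anticommutation of `J` with `V` and `W = V_x` matter, so block matrices
can be forgotten: moving every `J` to the left gives a normal form in which coefficients are
compared. Here `S` stands for `V_xx`, and the first summand for `J V_t` after the nonlinear equation
has been inserted. -/
theorem zero_curvature_algebra {𝔸 : Type*} [Ring 𝔸] [Algebra ℂ 𝔸] {J V W S : 𝔸} (z : ℂ)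
    (hJ : J * J = 1) (hV : V * J = -(J * V)) (hW : W * J = -(J * W)) :
    (-(Complex.I / 2)) • (S + (2 : ℂ) • (V * V * V))
        + ((Complex.I * z) • J + J * V)
          * (Complex.I • (z ^ 2 • J - (Complex.I * z) • (J * V) - (1 / 2 : ℂ) • (W + J * V ^ 2)))
      = Complex.I • (-((Complex.I * z) • (J * W)) - (1 / 2 : ℂ) • (S + J * (W * V + V * W)))
        + (Complex.I • (z ^ 2 • J - (Complex.I * z) • (J * V) - (1 / 2 : ℂ) • (W + J * V ^ 2)))
          * ((Complex.I * z) • J + J * V) := by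
  have hJ' : ∀ X, J * (J * X) = X := fun X => by rw [← mul_assoc, hJ, one_mul]
  have hV' : ∀ X, V * (J * X) = -(J * (V * X)) := fun X => by
    rw [← mul_assoc, hV, neg_mul, mul_assoc]
  have hW' : ∀ X, W * (J * X) = -(J * (W * X)) := fun X => by
    rw [← mul_assoc, hW, neg_mul, mul_assoc]
  simp only [sq, mul_add, add_mul, mul_sub, sub_mul, smul_mul_assoc, mul_smul_comm, mul_assoc,
    hJ, hJ', hV, hV', hW, hW', mul_neg, smul_neg, neg_neg]
  match_scalars <;> ring_nf
  simp

theorem zero_curvature (z : ℂ) {w p r τ : Matrix (Fin m₁) (Fin m₂) ℂ}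
    (h : (2 : ℂ) • τ + Complex.I • (r + (2 : ℂ) • (w * wᴴ * w)) = 0) :
    sigJ m₁ m₂ * potBlock τ + coeffG z w * coeffF z w p
      = coeffFDeriv z w p r + coeffF z w p * coeffG z w := by
  have hτ : τ = (-(Complex.I / 2)) • (r + (2 : ℂ) • (w * wᴴ * w)) := by
    have h1 : (2 : ℂ) • τ = -(Complex.I • (r + (2 : ℂ) • (w * wᴴ * w))) :=
      eq_neg_of_add_eq_zero_left h
    have h2 : τ = (1 / 2 : ℂ) • ((2 : ℂ) • τ) := by rw [smul_smul]; norm_num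
    rw [h2, h1, ← smul_neg, smul_smul, smul_neg, neg_smul]
    congr 2
    ring
  -- In the lower block the conjugation of `-i/2` and the sign from `j` cancel, so a single scalar
  -- serves both blocks.
  have hJτ : sigJ m₁ m₂ * potBlock τ = (-(Complex.I / 2)) •
      (potBlock r + (2 : ℂ) • (potBlock w * potBlock w * potBlock w)) := by
    rw [hτ]
    simp [sigJ, potBlock, fromBlocks_multiply, fromBlocks_smul, fromBlocks_add, Matrix.mul_assoc]
    rw [fromBlocks_neg]
    congr 1 <;> module
  rw [hJτ]
  exact zero_curvature_algebra z sigJ_mul_self (potBlock_mul_sigJ w) (potBlock_mul_sigJ p)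

/-! ### Regularity of `v` on the semi-strip, and the factorization of fundamental solutions. -/

section Strip

variable {a : ℝ} {v : ℝ → ℝ → Matrix (Fin m₁) (Fin m₂) ℂ}

theorem uniqueDiffOn_semiStrip (a : ℝ) : UniqueDiffOn ℝ (semiStrip a) :=
  (uniqueDiffOn_Ici 0).prod (uniqueDiffOn_Ico 0 a)

theorem hasDerivWithinAt_fderivWithin_fst
    (hv : ContDiffOn ℝ 1 (fun p : ℝ × ℝ => v p.1 p.2) (semiStrip a)) {x t : ℝ}
    (h : (x, t) ∈ semiStrip a) :
    HasDerivWithinAt (fun s => v s t)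
      (fderivWithin ℝ (fun p : ℝ × ℝ => v p.1 p.2) (semiStrip a) (x, t) (1, 0)) (Ici 0) x := by
  have hd := (hv.differentiableOn one_ne_zero (x, t) h).hasFDerivWithinAt
  exact hd.comp_hasDerivWithinAt x ((hasDerivWithinAt_id x (Ici 0)).prodMk
    (hasDerivWithinAt_const x (Ici 0) t)) (fun s hs => mk_mem_prod hs h.2)

theorem hasDerivWithinAt_fderivWithin_snd
    (hv : ContDiffOn ℝ 1 (fun p : ℝ × ℝ => v p.1 p.2) (semiStrip a)) {x t : ℝ}
    (h : (x, t) ∈ semiStrip a) :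
    HasDerivWithinAt (fun s => v x s)
      (fderivWithin ℝ (fun p : ℝ × ℝ => v p.1 p.2) (semiStrip a) (x, t) (0, 1)) (Ico 0 a) t := by
  have hd := (hv.differentiableOn one_ne_zero (x, t) h).hasFDerivWithinAt
  exact hd.comp_hasDerivWithinAt t ((hasDerivWithinAt_const t (Ico 0 a) x).prodMk
    (hasDerivWithinAt_id t (Ico 0 a))) (fun s hs => mk_mem_prod h.1 hs)

theorem partialX_eq (hv : ContDiffOn ℝ 1 (fun p : ℝ × ℝ => v p.1 p.2) (semiStrip a)) {x t : ℝ}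
    (h : (x, t) ∈ semiStrip a) : partialX v x t =
      fderivWithin ℝ (fun p : ℝ × ℝ => v p.1 p.2) (semiStrip a) (x, t) (1, 0) :=
  (hasDerivWithinAt_fderivWithin_fst hv h).derivWithin (uniqueDiffOn_Ici 0 x h.1)

theorem partialT_eq (hv : ContDiffOn ℝ 1 (fun p : ℝ × ℝ => v p.1 p.2) (semiStrip a)) {x t : ℝ}
    (h : (x, t) ∈ semiStrip a) : partialT a v x t =
      fderivWithin ℝ (fun p : ℝ × ℝ => v p.1 p.2) (semiStrip a) (x, t) (0, 1) :=
  (hasDerivWithinAt_fderivWithin_snd hv h).derivWithin (uniqueDiffOn_Ico 0 a t h.2)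

theorem hasDerivWithinAt_partialX
    (hv : ContDiffOn ℝ 1 (fun p : ℝ × ℝ => v p.1 p.2) (semiStrip a)) {x t : ℝ}
    (h : (x, t) ∈ semiStrip a) :
    HasDerivWithinAt (fun s => v s t) (partialX v x t) (Ici 0) x := by
  rw [partialX_eq hv h]; exact hasDerivWithinAt_fderivWithin_fst hv h

theorem hasDerivWithinAt_partialT
    (hv : ContDiffOn ℝ 1 (fun p : ℝ × ℝ => v p.1 p.2) (semiStrip a)) {x t : ℝ}
    (h : (x, t) ∈ semiStrip a) :
    HasDerivWithinAt (fun s => v x s) (partialT a v x t) (Ico 0 a) t := by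
  rw [partialT_eq hv h]; exact hasDerivWithinAt_fderivWithin_snd hv h

theorem continuousOn_partialX
    (hv : ContDiffOn ℝ 1 (fun p : ℝ × ℝ => v p.1 p.2) (semiStrip a)) :
    ContinuousOn (fun p : ℝ × ℝ => partialX v p.1 p.2) (semiStrip a) :=
  ((hv.continuousOn_fderivWithin (uniqueDiffOn_semiStrip a) le_rfl).clm_apply
    continuousOn_const).congr fun _ hp => partialX_eq hv hp

theorem continuousOn_partialT
    (hv : ContDiffOn ℝ 1 (fun p : ℝ × ℝ => v p.1 p.2) (semiStrip a)) :
    ContinuousOn (fun p : ℝ × ℝ => partialT a v p.1 p.2) (semiStrip a) :=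
  ((hv.continuousOn_fderivWithin (uniqueDiffOn_semiStrip a) le_rfl).clm_apply
    continuousOn_const).congr fun _ hp => partialT_eq hv hp

/-- The equation expresses `v_xx` through `v_t` and `v`, which are continuous. This joint continuity
is what differentiating `R(x,t)` in `x` requires. -/
theorem continuousOn_partialX_partialX
    (hv : ContDiffOn ℝ 1 (fun p : ℝ × ℝ => v p.1 p.2) (semiStrip a))
    (hNLS : ∀ x t : ℝ, (x, t) ∈ semiStrip a →
      (2 : ℂ) • partialT a v x t + Complex.I • (partialX (partialX v) x t
        + (2 : ℂ) • (v x t * (v x t)ᴴ * v x t)) = 0) :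
    ContinuousOn (fun p : ℝ × ℝ => partialX (partialX v) p.1 p.2) (semiStrip a) := by
  have h : ContinuousOn (fun p : ℝ × ℝ => Complex.I • ((2 : ℂ) • partialT a v p.1 p.2)
      - (2 : ℂ) • (v p.1 p.2 * (v p.1 p.2)ᴴ * v p.1 p.2)) (semiStrip a) := by
    have hc := hv.continuousOn
    refine (((continuousOn_partialT hv).const_smul (2 : ℂ)).const_smul Complex.I).sub
      (ContinuousOn.const_smul ?_ (2 : ℂ))
    rw [continuousOn_iff_continuous_domRestrict] at hc ⊢
    exact (hc.matrix_mul hc.matrix_conjTranspose).matrix_mul hc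
  refine h.congr fun p hp => ?_
  have := eq_neg_of_add_eq_zero_left (hNLS p.1 p.2 hp)
  simp only [this, smul_neg, smul_smul, Complex.I_mul_I]
  simp

end Strip

/-- The factorization `R(x,t) u(x,0) = u(x,t) R(0,t)` for solutions of a zero curvature system. -/
theorem fundamentalSolution_factorization {a : ℝ}
    {v : ℝ → ℝ → Matrix (Fin m₁) (Fin m₂) ℂ}
    (hv : ContDiffOn ℝ 1 (fun p : ℝ × ℝ => v p.1 p.2) (semiStrip a))
    (hvxx : ∀ x t : ℝ, (x, t) ∈ semiStrip a →
      DifferentiableWithinAt ℝ (fun s => partialX v s t) (Ici 0) x)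
    (hNLS : ∀ x t : ℝ, (x, t) ∈ semiStrip a →
      (2 : ℂ) • partialT a v x t + Complex.I • (partialX (partialX v) x t
        + (2 : ℂ) • (v x t * (v x t)ᴴ * v x t)) = 0)
    {z : ℂ} {R : ℝ → ℝ → BlockMat m₁ m₂}
    (hR : ∀ x ∈ Ici (0 : ℝ), IsFundamentalSolution (Ico 0 a)
      (fun t => coeffF z (v x t) (partialX v x t)) (R x))
    {T : ℝ} (hT : T ∈ Ico 0 a) {u₀ u : ℝ → BlockMat m₁ m₂}
    (hu₀ : IsFundamentalSolution (Ici 0) (fun x => coeffG z (v x 0)) u₀)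
    (hu : IsFundamentalSolution (Ici 0) (fun x => coeffG z (v x T)) u) {x : ℝ} (hx : 0 ≤ x) :
    R x T * u₀ x = u x * R 0 T := by
  have hTa : Icc 0 T ⊆ Ico 0 a := fun s hs => ⟨hs.1, hs.2.trans_lt hT.2⟩
  have h0a : (0 : ℝ) ∈ Ico 0 a := ⟨le_rfl, hT.1.trans_lt hT.2⟩
  have hstrip : Ici (0 : ℝ) ×ˢ Icc 0 T ⊆ semiStrip a := prod_mono le_rfl hTa
  have hslice : ∀ y ∈ Ici (0 : ℝ), MapsTo (fun t : ℝ => (y, t)) (Icc 0 T) (semiStrip a) :=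
    fun y hy t ht => ⟨hy, hTa ht⟩
  have hpair : ∀ y : ℝ, ContinuousOn (fun t : ℝ => (y, t)) (Icc 0 T) := fun y =>
    (Continuous.prodMk_right y).continuousOn
  have hBc : ContinuousOn (fun p : ℝ × ℝ => coeffFDeriv z (v p.1 p.2) (partialX v p.1 p.2)
      (partialX (partialX v) p.1 p.2)) (Ici 0 ×ˢ Icc 0 T) :=
    continuousOn_coeffFDeriv z (hv.continuousOn.mono hstrip)
      ((continuousOn_partialX hv).mono hstrip) ((continuousOn_partialX_partialX hv hNLS).mono hstrip)
  have hRd : ∀ y ∈ Ici (0 : ℝ), ∀ t ∈ Icc 0 T,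
      HasDerivWithinAt (R y) (coeffF z (v y t) (partialX v y t) * R y t) (Icc 0 T) t :=
    fun y hy t ht => ((hR y hy).2 t (hTa ht)).mono hTa
  -- The candidate `Q = G(y,t) R - R G(y,0)` vanishes at `t = 0`, and by zero curvature `Q_t = F Q +
  -- F_x R`, the equation which the `x`-derivative of `R` must solve.
  have hRx : ∀ y ∈ Ici (0 : ℝ), HasDerivWithinAt (fun s => R s T)
      (coeffG z (v y T) * R y T - R y T * coeffG z (v y 0)) (Ici 0) y := by
    intro y hy
    have hvy : ContinuousOn (fun t => v y t) (Icc 0 T) :=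
      hv.continuousOn.comp (f := fun t : ℝ => (y, t)) (hpair y) (hslice y hy)
    have hpy : ContinuousOn (fun t => partialX v y t) (Icc 0 T) :=
      (continuousOn_partialX hv).comp (f := fun t : ℝ => (y, t)) (hpair y) (hslice y hy)
    have hry : ContinuousOn (fun t => partialX (partialX v) y t) (Icc 0 T) :=
      (continuousOn_partialX_partialX hv hNLS).comp (f := fun t : ℝ => (y, t)) (hpair y)
        (hslice y hy)
    refine hasDerivWithinAt_param_linearODE hT.1 hy
      (A := fun y t => coeffF z (v y t) (partialX v y t))
      (B := fun t => coeffFDeriv z (v y t) (partialX v y t) (partialX (partialX v) y t))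
      (Q := fun t => coeffG z (v y t) * R y t - R y t * coeffG z (v y 0))
      (continuousOn_coeffF z hvy hpy) (continuousOn_coeffFDeriv z hvy hpy hry) ?_ hRd
      (fun s hs => (hR s hs).1) ?_ ?_
    · intro ε hε
      exact eventually_forall_norm_sub_sub_le hy
        (A := fun y t => coeffF z (v y t) (partialX v y t))
        (B := fun y t => coeffFDeriv z (v y t) (partialX v y t) (partialX (partialX v) y t))
        hBc (fun s hs t ht => hasDerivWithinAt_coeffF z
          (q := fun s => v s t) (p := fun s => partialX v s t)
          (hasDerivWithinAt_partialX hv ⟨hs, hTa ht⟩)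
          (hvxx s t ⟨hs, hTa ht⟩).hasDerivWithinAt) hε
    · intro t ht
      have hG := hasDerivWithinAt_coeffG z
        ((hasDerivWithinAt_partialT hv (x := y) (t := t) ⟨hy, hTa ht⟩).mono hTa)
      have hr := hRd y hy t ht
      refine ((hG.mul hr).sub (hr.mul_const (coeffG z (v y 0)))).congr_deriv ?_
      have hzc := zero_curvature z (p := partialX v y t) (hNLS y t ⟨hy, hTa ht⟩)
      calc _ = (sigJ m₁ m₂ * potBlock (partialT a v y t)
            + coeffG z (v y t) * coeffF z (v y t) (partialX v y t)) * R y t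
            - coeffF z (v y t) (partialX v y t) * R y t * coeffG z (v y 0) := by noncomm_ring
        _ = _ := by rw [hzc]; noncomm_ring
    · simp [(hR y hy).1]
  have hxi : Icc 0 x ⊆ Ici (0 : ℝ) := Icc_subset_Ici_self
  have hGc : ContinuousOn (fun y => coeffG z (v y T)) (Icc 0 x) :=
    continuousOn_coeffG z (hv.continuousOn.comp (f := fun y : ℝ => (y, T))
      (Continuous.prodMk_left T).continuousOn fun y hy => ⟨hxi hy, hT⟩)
  -- Both sides solve `Y' = G(x,T) Y` with the value `R 0 T` at `x = 0`.
  refine linearODE_unique (T := x) hGc (Y := fun y => R y T * u₀ y) (Z := fun y => u y * R 0 T)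
    (fun y hy => ?_) (fun y hy => ?_) ?_ x ⟨hx, le_rfl⟩
  · refine (((hRx y (hxi hy)).mul (hu₀.2 y (hxi hy))).mono hxi).congr_deriv ?_
    noncomm_ring
  · refine (((hu.2 y (hxi hy)).mul_const (R 0 T)).mono hxi).congr_deriv ?_
    noncomm_ring
  · simp [hu₀.1, hu.1]

/-! ### Quadratic forms along solutions. -/

section Forms

variable {n : Type*} [Fintype n]

/-- The real part of the sesquilinear form of a matrix. -/
noncomputable def reForm (H : Matrix n n ℂ) (f : n → ℂ) : ℝ := (star f ⬝ᵥ (H *ᵥ f)).re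

/-- The squared Euclidean length of a vector. -/
noncomputable def lenSq {ι : Type*} [Fintype ι] (f : ι → ℂ) : ℝ := ∑ i, ‖f i‖ ^ 2

theorem lenSq_eq_norm_sq {ι : Type*} [Fintype ι] (f : ι → ℂ) :
    lenSq f = ‖(WithLp.toLp 2 f : EuclideanSpace ℂ ι)‖ ^ 2 := by
  rw [EuclideanSpace.norm_sq_eq]; rfl

theorem lenSq_nonneg {ι : Type*} [Fintype ι] (f : ι → ℂ) : 0 ≤ lenSq f :=
  Finset.sum_nonneg fun _ _ => sq_nonneg _

theorem lenSq_eq_zero {ι : Type*} [Fintype ι] {f : ι → ℂ} : lenSq f = 0 ↔ f = 0 := by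
  rw [lenSq_eq_norm_sq, sq_eq_zero_iff, norm_eq_zero, WithLp.toLp_eq_zero]

theorem lenSq_eq_zero_of_le {ι : Type*} [Fintype ι] {f : ι → ℂ} (h : lenSq f ≤ 0) : f = 0 :=
  lenSq_eq_zero.1 (le_antisymm h (lenSq_nonneg f))

theorem re_star_dotProduct_self {ι : Type*} [Fintype ι] (f : ι → ℂ) :
    (star f ⬝ᵥ f).re = lenSq f := by
  simp only [dotProduct, Complex.re_sum, lenSq]
  refine Finset.sum_congr rfl fun i _ => ?_
  rw [Pi.star_apply, Complex.star_def, Complex.conj_mul', ← Complex.ofReal_pow, Complex.ofReal_re]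

theorem abs_re_star_dotProduct_le {ι : Type*} [Fintype ι] (f g : ι → ℂ) :
    |(star f ⬝ᵥ g).re| ≤ ‖(WithLp.toLp 2 f : EuclideanSpace ℂ ι)‖
      * ‖(WithLp.toLp 2 g : EuclideanSpace ℂ ι)‖ := by
  refine (Complex.abs_re_le_norm _).trans ?_
  rw [dotProduct_comm, ← EuclideanSpace.inner_toLp_toLp]
  exact norm_inner_le_norm _ _

theorem norm_toLp_mulVec_le {ι κ : Type*} [Fintype ι] [Fintype κ] [DecidableEq κ]
    (A : Matrix ι κ ℂ) (f : κ → ℂ) :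
    ‖(WithLp.toLp 2 (A *ᵥ f) : EuclideanSpace ℂ ι)‖
      ≤ ‖A‖ * ‖(WithLp.toLp 2 f : EuclideanSpace ℂ κ)‖ :=
  l2_opNorm_mulVec A (WithLp.toLp 2 f)

theorem lenSq_sub_le {ι : Type*} [Fintype ι] (f g : ι → ℂ) :
    lenSq (f - g) ≤ 2 * (lenSq f + lenSq g) := by
  rw [lenSq_eq_norm_sq, lenSq_eq_norm_sq, lenSq_eq_norm_sq, WithLp.toLp_sub]
  have h := norm_sub_le (WithLp.toLp 2 f : EuclideanSpace ℂ ι) (WithLp.toLp 2 g)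
  have h0 := norm_nonneg (WithLp.toLp 2 f - WithLp.toLp 2 g : EuclideanSpace ℂ ι)
  nlinarith [sq_nonneg (‖(WithLp.toLp 2 f : EuclideanSpace ℂ ι)‖
    - ‖(WithLp.toLp 2 g : EuclideanSpace ℂ ι)‖)]

theorem lenSq_sum_elim {ι κ : Type*} [Fintype ι] [Fintype κ] (f : ι → ℂ) (g : κ → ℂ) :
    lenSq (Sum.elim f g) = lenSq f + lenSq g := by
  simp [lenSq]

theorem reForm_one [DecidableEq n] (f : n → ℂ) : reForm 1 f = lenSq f := by
  rw [reForm, one_mulVec, re_star_dotProduct_self]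

theorem abs_reForm_le [DecidableEq n] (H : Matrix n n ℂ) (f : n → ℂ) : |reForm H f| ≤ ‖H‖ * lenSq f := by
  refine (abs_re_star_dotProduct_le f (H *ᵥ f)).trans ?_
  rw [lenSq_eq_norm_sq]
  have := norm_toLp_mulVec_le H f
  calc _ ≤ ‖(WithLp.toLp 2 f : EuclideanSpace ℂ n)‖
        * (‖H‖ * ‖(WithLp.toLp 2 f : EuclideanSpace ℂ n)‖) := by gcongr
    _ = _ := by ring

theorem reForm_conjTranspose_mul_mul {κ : Type*} [Fintype κ] (U : Matrix n κ ℂ)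
    (H : Matrix n n ℂ) (f : κ → ℂ) :
    (star f ⬝ᵥ ((Uᴴ * H * U) *ᵥ f)).re = reForm H (U *ᵥ f) := by
  rw [reForm, star_mulVec, ← mulVec_mulVec, ← mulVec_mulVec, dotProduct_mulVec]

/-- The value of `reForm` at a fixed vector as a continuous real-linear map. -/
noncomputable def reFormL (f : n → ℂ) : Matrix n n ℂ →L[ℝ] ℝ :=
  LinearMap.toContinuousLinearMap
    { toFun := fun H => reForm H f
      map_add' := fun H K => by simp [reForm, add_mulVec, dotProduct_add]
      map_smul' := fun c H => by simp [reForm, smul_mulVec, dotProduct_smul] }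

@[simp] theorem reFormL_apply (f : n → ℂ) (H : Matrix n n ℂ) : reFormL f H = reForm H f := rfl

theorem reForm_add (H K : Matrix n n ℂ) (f : n → ℂ) :
    reForm (H + K) f = reForm H f + reForm K f := (reFormL f).map_add H K

theorem reForm_smul (c : ℝ) (H : Matrix n n ℂ) (f : n → ℂ) :
    reForm (c • H) f = c * reForm H f := (reFormL f).map_smul c H

/-- Applied with `H = j` to the Dirac system (energy) and with `H = 1` to the auxiliary system
(length). -/
theorem HasDerivWithinAt.reForm [DecidableEq n] {Y A : ℝ → Matrix n n ℂ} {s : Set ℝ} {x : ℝ}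
    (h : HasDerivWithinAt Y (A x * Y x) s x) (H : Matrix n n ℂ) (f : n → ℂ) :
    HasDerivWithinAt (fun y => reForm H (Y y *ᵥ f))
      (reForm ((A x)ᴴ * H + H * A x) (Y x *ᵥ f)) s x := by
  have h1 : HasDerivWithinAt (fun y => (Y y)ᴴ) ((A x * Y x)ᴴ) s x := h.star
  have h2 := (reFormL f).hasFDerivAt.comp_hasDerivWithinAt x ((h1.mul_const H).mul h)
  refine (h2.congr_deriv ?_).congr (fun y _ => ?_) ?_
  · rw [← reForm_conjTranspose_mul_mul]
    simp only [reFormL_apply, FocusingNLS.reForm]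
    rw [conjTranspose_mul]
    congr 3
    noncomm_ring
  · exact (reForm_conjTranspose_mul_mul _ _ _).symm
  · exact (reForm_conjTranspose_mul_mul _ _ _).symm

/-- If `Z' = -A* Z` and `Z 0 = 1`, then `Z* Y` has derivative zero, hence equals 1. -/
theorem isUnit_det_of_linearODE [DecidableEq n] {T : ℝ} {A Y : ℝ → Matrix n n ℂ}
    (hA : ContinuousOn A (Icc 0 T)) (hY0 : Y 0 = 1)
    (hY : ∀ t ∈ Icc 0 T, HasDerivWithinAt Y (A t * Y t) (Icc 0 T) t) {t : ℝ} (ht : t ∈ Icc 0 T) :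
    IsUnit (Y t).det := by
  obtain ⟨Z, hZ0, hZ⟩ := exists_linearODE_of_continuous
    (fun t => -(A (max 0 (min T t)))ᴴ)
    ((hA.comp_continuous (continuous_const.max (continuous_const.min continuous_id)) fun s =>
      ⟨le_max_left _ _, max_le (ht.1.trans ht.2) (min_le_left _ _)⟩).matrix_conjTranspose.neg)
  have hd : ∀ s ∈ Icc 0 T, HasDerivWithinAt (fun s => (Z s)ᴴ * Y s) 0 (Icc 0 T) s := by
    intro s hs
    have h1 : HasDerivWithinAt (fun s => (Z s)ᴴ) _ (Icc 0 T) s :=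
      ((hZ s hs.1).hasDerivWithinAt).star
    refine (h1.mul (hY s hs)).congr_deriv ?_
    rw [min_eq_right hs.2, max_eq_right hs.1, star_eq_conjTranspose, conjTranspose_mul,
      conjTranspose_neg, conjTranspose_conjTranspose]
    noncomm_ring
  have hc := constant_of_derivWithin_zero (fun s hs => (hd s hs).differentiableWithinAt)
    (fun s hs => (hd s (Ico_subset_Icc_self hs)).derivWithin
      (uniqueDiffOn_Icc (hs.1.trans_lt hs.2) s (Ico_subset_Icc_self hs))) t ht
  rw [hY0, hZ0, conjTranspose_one, one_mul] at hc
  exact (Matrix.isUnit_iff_isUnit_det _).1 (IsUnit.of_mul_eq_one_right _ hc)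

end Forms

/-! ### Form estimates for `G` and `F`; graphs with nonnegative `j`-form. -/

theorem antitoneOn_Ici_of_hasDerivWithinAt {X : ℝ} (hX : 0 ≤ X) {f f' : ℝ → ℝ}
    (hf : ∀ x ∈ Ici (0 : ℝ), HasDerivWithinAt f (f' x) (Ici 0) x)
    (hf' : ∀ x ∈ Ici X, f' x ≤ 0) : AntitoneOn f (Ici X) := by
  have hsub : Ici X ⊆ Ici (0 : ℝ) := Ici_subset_Ici.2 hX
  exact antitoneOn_of_hasDerivWithinAt_nonpos (convex_Ici X)
    (fun x hx => (hf x (hsub hx)).continuousWithinAt.mono hsub)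
    (fun x hx => (hf x (hsub (interior_subset hx))).mono (interior_subset.trans hsub))
    (fun x hx => hf' x (interior_subset hx))

theorem reForm_sigJ (f : Fin m₁ → ℂ) (g : Fin m₂ → ℂ) :
    reForm (sigJ m₁ m₂) (Sum.elim f g) = lenSq f - lenSq g := by
  rw [← re_star_dotProduct_self, ← re_star_dotProduct_self]
  simp [reForm, sigJ, fromBlocks_mulVec, dotProduct, neg_mulVec, sub_eq_add_neg]

theorem reForm_sigJ_neg_le (f : Fin m₁ ⊕ Fin m₂ → ℂ) : -lenSq f ≤ reForm (sigJ m₁ m₂) f := by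
  rw [← Sum.elim_comp_inl_inr f, reForm_sigJ, lenSq_sum_elim]
  linarith [lenSq_nonneg (f ∘ Sum.inl)]

theorem reForm_potBlock_le (w : Matrix (Fin m₁) (Fin m₂) ℂ) (f : Fin m₁ ⊕ Fin m₂ → ℂ) :
    reForm (potBlock w) f ≤ ‖w‖ * lenSq f := by
  have hf := Sum.elim_comp_inl_inr f
  set p := f ∘ Sum.inl
  set q := f ∘ Sum.inr
  rw [← hf, lenSq_sum_elim]
  have h : reForm (potBlock w) (Sum.elim p q)
      = (star p ⬝ᵥ (w *ᵥ q)).re + (star q ⬝ᵥ (wᴴ *ᵥ p)).re := by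
    simp [reForm, potBlock, fromBlocks_mulVec, dotProduct]
  have h1 := (le_abs_self _).trans (abs_re_star_dotProduct_le p (w *ᵥ q))
  have h2 := (le_abs_self _).trans (abs_re_star_dotProduct_le q (wᴴ *ᵥ p))
  have h3 := norm_toLp_mulVec_le w q
  have h4 := norm_toLp_mulVec_le wᴴ p
  rw [l2_opNorm_conjTranspose] at h4
  rw [h, lenSq_eq_norm_sq, lenSq_eq_norm_sq]
  set P := ‖(WithLp.toLp 2 p : EuclideanSpace ℂ (Fin m₁))‖
  set Q := ‖(WithLp.toLp 2 q : EuclideanSpace ℂ (Fin m₂))‖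
  have hP : 0 ≤ P := norm_nonneg _
  have hQ : 0 ≤ Q := norm_nonneg _
  calc _ ≤ P * (‖w‖ * Q) + Q * (‖w‖ * P) :=
        add_le_add (h1.trans (by gcongr)) (h2.trans (by gcongr))
    _ = ‖w‖ * (2 * P * Q) := by ring
    _ ≤ ‖w‖ * (P ^ 2 + Q ^ 2) := by
        gcongr
        exact two_mul_le_add_sq P Q

/-- The term `i z j` contributes `i z` plus its conjugate, and each of the two terms with `j V`
contributes `V`. Since `V` is controlled by `M`, the energy is dissipated once `Im z > M`. -/
theorem coeffG_sigJ (z : ℂ) (w : Matrix (Fin m₁) (Fin m₂) ℂ) :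
    (coeffG z w)ᴴ * sigJ m₁ m₂ + sigJ m₁ m₂ * coeffG z w
      = (-2 * z.im) • (1 : BlockMat m₁ m₂) + (2 : ℝ) • potBlock w := by
  have hJ := sigJ_mul_self (m₁ := m₁) (m₂ := m₂)
  have hJ' : ∀ X, sigJ m₁ m₂ * (sigJ m₁ m₂ * X) = X := fun X => by
    rw [← Matrix.mul_assoc, hJ, Matrix.one_mul]
  simp only [coeffG, conjTranspose_add, conjTranspose_smul, conjTranspose_mul, sigJ_conjTranspose,
    potBlock_conjTranspose, add_mul, mul_add, smul_mul_assoc, mul_smul_comm, hJ, hJ',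
    Matrix.mul_assoc, Matrix.mul_one]
  have h : star (Complex.I * z) + Complex.I * z = ((-2 * z.im : ℝ) : ℂ) := by
    apply Complex.ext <;> simp; ring
  have e : (-2 * z.im) • (1 : BlockMat m₁ m₂) = ((-2 * z.im : ℝ) : ℂ) • (1 : BlockMat m₁ m₂) := by
    ext i k; simp
  rw [e, ← h, add_smul, two_smul]
  abel

theorem reForm_coeffG_le {z : ℂ} {w : Matrix (Fin m₁) (Fin m₂) ℂ} {M : ℝ} (hw : ‖w‖ ≤ M)
    (f : Fin m₁ ⊕ Fin m₂ → ℂ) :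
    reForm ((coeffG z w)ᴴ * sigJ m₁ m₂ + sigJ m₁ m₂ * coeffG z w) f
      ≤ -(2 * (z.im - M)) * lenSq f := by
  rw [coeffG_sigJ, reForm_add, reForm_smul, reForm_smul, reForm_one]
  have h := reForm_potBlock_le w f
  have := mul_le_mul_of_nonneg_right hw (lenSq_nonneg f)
  linarith

/-- `V_x` and `j V²` are Hermitian (`j` commutes with `V²`) and enter `F` with an imaginary factor,
so they cancel. The absence of `p` on the right is what makes growth bounds uniform in `x`. -/
theorem coeffF_add_conjTranspose (z : ℂ) (w p : Matrix (Fin m₁) (Fin m₂) ℂ) :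
    (coeffF z w p)ᴴ * 1 + 1 * coeffF z w p
      = (Complex.I * z ^ 2 + star (Complex.I * z ^ 2)) • sigJ m₁ m₂
        + (z • (sigJ m₁ m₂ * potBlock w) + star z • (potBlock w * sigJ m₁ m₂)) := by
  have h1 : potBlock w ^ 2 * sigJ m₁ m₂ = sigJ m₁ m₂ * potBlock w ^ 2 := by
    rw [sq, Matrix.mul_assoc, potBlock_mul_sigJ, mul_neg, ← Matrix.mul_assoc, potBlock_mul_sigJ,
      neg_mul, neg_neg, Matrix.mul_assoc]
  have hI : (starRingEnd ℂ) Complex.I = -Complex.I := Complex.conj_I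
  simp only [coeffF, conjTranspose_smul, conjTranspose_sub, conjTranspose_add, conjTranspose_mul,
    conjTranspose_pow, sigJ_conjTranspose, potBlock_conjTranspose, h1, Matrix.mul_one,
    Matrix.one_mul, star_mul', star_pow, Complex.star_def, hI]
  have h2 : (starRingEnd ℂ) (1 / 2 : ℂ) = 1 / 2 := by
    rw [map_div₀, map_one, map_ofNat]
  rw [h2]
  match_scalars <;> ring_nf <;> simp

theorem exists_reForm_coeffF_le (m₁ m₂ : ℕ) (z : ℂ) (M : ℝ) : ∃ C : ℝ, 0 ≤ C ∧
    ∀ w p : Matrix (Fin m₁) (Fin m₂) ℂ, ‖w‖ ≤ M → ∀ f : Fin m₁ ⊕ Fin m₂ → ℂ,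
      reForm ((coeffF z w p)ᴴ * 1 + 1 * coeffF z w p) f ≤ C * lenSq f := by
  set J := sigJ m₁ m₂
  set c := Complex.I * z ^ 2 + star (Complex.I * z ^ 2)
  set B := ‖potBlockL m₁ m₂‖ * |M|
  refine ⟨‖c‖ * ‖J‖ + (‖z‖ * (‖J‖ * B) + ‖star z‖ * (B * ‖J‖)), by positivity, ?_⟩
  intro w p hw f
  refine (le_abs_self _).trans ((abs_reForm_le _ f).trans ?_)
  have hB : ‖potBlock w‖ ≤ B :=
    ((potBlockL m₁ m₂).le_opNorm w).trans (mul_le_mul_of_nonneg_left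
      (hw.trans (le_abs_self M)) (norm_nonneg _))
  refine mul_le_mul_of_nonneg_right ?_ (lenSq_nonneg f)
  rw [coeffF_add_conjTranspose]
  refine (norm_add_le _ _).trans (add_le_add (norm_smul_le _ _)
    ((norm_add_le _ _).trans (add_le_add ?_ ?_)))
  · refine (norm_smul_le _ _).trans (mul_le_mul_of_nonneg_left ?_ (norm_nonneg _))
    exact (norm_mul_le _ _).trans (mul_le_mul_of_nonneg_left hB (norm_nonneg _))
  · refine (norm_smul_le _ _).trans (mul_le_mul_of_nonneg_left ?_ (norm_nonneg _))
    exact (norm_mul_le _ _).trans (mul_le_mul_of_nonneg_right hB (norm_nonneg _))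

/-- The vector with upper block `f` and lower block `w f`. -/
def graphVec (w : Matrix (Fin m₂) (Fin m₁) ℂ) (f : Fin m₁ → ℂ) : Fin m₁ ⊕ Fin m₂ → ℂ :=
  Sum.elim f (w *ᵥ f)

/-- The matrix of `graphVec w`. -/
def graphMat (w : Matrix (Fin m₂) (Fin m₁) ℂ) : Matrix (Fin m₁ ⊕ Fin m₂) (Fin m₁) ℂ :=
  fromRows 1 w

theorem graphMat_mulVec (w : Matrix (Fin m₂) (Fin m₁) ℂ) (f : Fin m₁ → ℂ) :
    graphMat w *ᵥ f = graphVec w f := by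
  rw [graphMat, fromRows_mulVec, one_mulVec]; rfl

theorem graphVec_injective (w : Matrix (Fin m₂) (Fin m₁) ℂ) :
    Function.Injective (graphVec w) := fun f g h => by
  ext i; exact congrFun h (Sum.inl i)

theorem graphVec_sub (w w' : Matrix (Fin m₂) (Fin m₁) ℂ) (f : Fin m₁ → ℂ) :
    graphVec w f - graphVec w' f = Sum.elim (0 : Fin m₁ → ℂ) ((w - w') *ᵥ f) := by
  ext i
  cases i <;> simp [graphVec, sub_mulVec]

/-- `Y` maps all vectors `(f, w f)` to vectors on which the form of `j` is nonnegative. -/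
def IsJNonneg (Y : BlockMat m₁ m₂) (w : Matrix (Fin m₂) (Fin m₁) ℂ) : Prop :=
  ∀ f, 0 ≤ reForm (sigJ m₁ m₂) (Y *ᵥ graphVec w f)

theorem isHermitian_conjTranspose_sigJ (P : Matrix (Fin m₁ ⊕ Fin m₂) (Fin m₁) ℂ) :
    (Pᴴ * sigJ m₁ m₂ * P).IsHermitian := by
  rw [IsHermitian, conjTranspose_mul, conjTranspose_mul, conjTranspose_conjTranspose,
    sigJ_conjTranspose, Matrix.mul_assoc]

theorem reForm_sigJ_nonneg_of_posSemidef {P : Matrix (Fin m₁ ⊕ Fin m₂) (Fin m₁) ℂ}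
    (h : (Pᴴ * sigJ m₁ m₂ * P).PosSemidef) (f : Fin m₁ → ℂ) :
    0 ≤ reForm (sigJ m₁ m₂) (P *ᵥ f) := by
  rw [← reForm_conjTranspose_mul_mul]
  exact (Complex.le_def.1 (h.dotProduct_mulVec_nonneg f)).1

theorem posSemidef_of_reForm_sigJ_nonneg {P : Matrix (Fin m₁ ⊕ Fin m₂) (Fin m₁) ℂ}
    (h : ∀ f, 0 ≤ reForm (sigJ m₁ m₂) (P *ᵥ f)) : (Pᴴ * sigJ m₁ m₂ * P).PosSemidef := by
  refine PosSemidef.of_dotProduct_mulVec_nonneg (isHermitian_conjTranspose_sigJ P) fun f => ?_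
  rw [Complex.le_def]
  refine ⟨?_, ?_⟩
  · rw [reForm_conjTranspose_mul_mul]; exact h f
  · exact ((isHermitian_conjTranspose_sigJ P).im_star_dotProduct_mulVec_self f).symm

theorem injective_mulVec_of_posDef {P : Matrix (Fin m₁ ⊕ Fin m₂) (Fin m₁) ℂ}
    (h : (Pᴴ * P).PosDef) {f : Fin m₁ → ℂ} (hf : P *ᵥ f = 0) : f = 0 := by
  by_contra hne
  have := h.dotProduct_mulVec_pos hne
  rw [← mulVec_mulVec, hf, mulVec_zero, dotProduct_zero] at this
  exact lt_irrefl _ this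

theorem isUnit_det_of_mulVec_eq_zero {n : Type*} [Fintype n] [DecidableEq n] {A : Matrix n n ℂ}
    (h : ∀ f, A *ᵥ f = 0 → f = 0) : IsUnit A.det := by
  rw [← Matrix.isUnit_iff_isUnit_det, ← mulVec_injective_iff_isUnit]
  intro f g hfg
  refine sub_eq_zero.1 (h _ ?_)
  rw [mulVec_sub, sub_eq_zero]; exact hfg

/-- On the graph of `w = Q₂ Q₁⁻¹` lie exactly the vectors of the range of `Q`. -/
theorem graphVec_mul_inv {Q₁ : Matrix (Fin m₁) (Fin m₁) ℂ} (hQ : IsUnit Q₁.det)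
    (Q₂ : Matrix (Fin m₂) (Fin m₁) ℂ) (f : Fin m₁ → ℂ) :
    graphVec (Q₂ * Q₁⁻¹) f = Sum.elim (Q₁ *ᵥ (Q₁⁻¹ *ᵥ f)) (Q₂ *ᵥ (Q₁⁻¹ *ᵥ f)) := by
  rw [graphVec, mulVec_mulVec, mulVec_mulVec, mul_nonsing_inv _ hQ, one_mulVec]

/-! ### The Dirac system: description of `𝒩(x,z)`, existence and uniqueness of the Weyl function,
decay. -/

section Dirac

variable {M : ℝ} {q : ℝ → Matrix (Fin m₁) (Fin m₂) ℂ} {z : ℂ} {u : ℝ → BlockMat m₁ m₂}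

theorem IsFundamentalSolution.eq_of_continuousOn {A u u' : ℝ → BlockMat m₁ m₂}
    (hA : ContinuousOn A (Ici 0)) (hu : IsFundamentalSolution (Ici 0) A u)
    (hu' : IsFundamentalSolution (Ici 0) A u') {x : ℝ} (hx : 0 ≤ x) : u x = u' x :=
  linearODE_unique (T := x) (hA.mono Icc_subset_Ici_self)
    (fun t ht => (hu.2 t ht.1).mono Icc_subset_Ici_self)
    (fun t ht => (hu'.2 t ht.1).mono Icc_subset_Ici_self) (hu.1.trans hu'.1.symm) x ⟨hx, le_rfl⟩

theorem IsFundamentalSolution.isUnit_det {s : Set ℝ} {A Y : ℝ → BlockMat m₁ m₂}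
    (hY : IsFundamentalSolution s A Y) (hA : ContinuousOn A s) {x : ℝ} (hx : 0 ≤ x)
    (hs : Icc 0 x ⊆ s) : IsUnit (Y x).det :=
  isUnit_det_of_linearODE (hA.mono hs) hY.1 (fun t ht => (hY.2 t (hs ht)).mono hs) ⟨hx, le_rfl⟩

theorem exists_fundamentalSolution_coeffG (hq : ContinuousOn q (Ici 0)) (z : ℂ) :
    ∃ u, IsFundamentalSolution (Ici 0) (fun s => coeffG z (q s)) u :=
  exists_linearODE_Ici (continuousOn_coeffG z hq)

theorem hasDerivWithinAt_energy (hu : IsFundamentalSolution (Ici 0) (fun s => coeffG z (q s)) u)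
    (f : Fin m₁ ⊕ Fin m₂ → ℂ) {x : ℝ} (hx : x ∈ Ici (0 : ℝ)) :
    HasDerivWithinAt (fun s => reForm (sigJ m₁ m₂) (u s *ᵥ f))
      (reForm ((coeffG z (q x))ᴴ * sigJ m₁ m₂ + sigJ m₁ m₂ * coeffG z (q x)) (u x *ᵥ f))
      (Ici 0) x :=
  HasDerivWithinAt.reForm (A := fun s => coeffG z (q s)) (hu.2 x hx) (sigJ m₁ m₂) f

theorem antitoneOn_energy (hqM : ∀ x, 0 ≤ x → ‖q x‖ ≤ M) (hz : M < z.im)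
    (hu : IsFundamentalSolution (Ici 0) (fun s => coeffG z (q s)) u)
    (f : Fin m₁ ⊕ Fin m₂ → ℂ) :
    AntitoneOn (fun s => reForm (sigJ m₁ m₂) (u s *ᵥ f)) (Ici 0) :=
  antitoneOn_Ici_of_hasDerivWithinAt le_rfl (fun _ hx => hasDerivWithinAt_energy hu f hx)
    fun x hx => (reForm_coeffG_le (hqM x hx) _).trans
      (mul_nonpos_of_nonpos_of_nonneg (by linarith) (lenSq_nonneg _))

theorem energy_le (hqM : ∀ x, 0 ≤ x → ‖q x‖ ≤ M) (hz : M < z.im)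
    (hu : IsFundamentalSolution (Ici 0) (fun s => coeffG z (q s)) u)
    (f : Fin m₁ ⊕ Fin m₂ → ℂ) {x : ℝ} (hx : 0 ≤ x) :
    reForm (sigJ m₁ m₂) (u x *ᵥ f) ≤ reForm (sigJ m₁ m₂) f := by
  have := antitoneOn_energy hqM hz hu f (mem_Ici.2 le_rfl) (mem_Ici.2 hx) hx
  simpa [hu.1] using this

/-- The graph of `Q₂ Q₁⁻¹`, with `Q = u⁻¹ P`, is the range of `Q`, and `u` maps it to the range of
`P`. Conversely a constant parameter realizes every admissible `w`. -/
theorem mem_mobiusSet_iff (hq : ContinuousOn q (Ici 0)) (hqM : ∀ x, 0 ≤ x → ‖q x‖ ≤ M)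
    (hz : M < z.im) (hu : IsFundamentalSolution (Ici 0) (fun s => coeffG z (q s)) u)
    {x : ℝ} (hx : 0 ≤ x) {w : Matrix (Fin m₂) (Fin m₁) ℂ} :
    w ∈ mobiusSet M q x z ↔ IsJNonneg (u x) w := by
  have hdet : IsUnit (u x).det :=
    hu.isUnit_det (continuousOn_coeffG z hq) hx Icc_subset_Ici_self
  constructor
  · rintro ⟨u', P, -, hu', -, ⟨hP, hPJ⟩, rfl⟩ f
    rw [← hu.eq_of_continuousOn (continuousOn_coeffG z hq) hu' hx]
    set Q : Matrix (Fin m₁ ⊕ Fin m₂) (Fin m₁) ℂ := (u x)⁻¹ * P z with hQ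
    have huQ : u x * Q = P z := by rw [hQ, ← Matrix.mul_assoc, mul_nonsing_inv _ hdet, Matrix.one_mul]
    have hQf : ∀ g, Q *ᵥ g = Sum.elim (toRows₁ Q *ᵥ g) (toRows₂ Q *ᵥ g) := fun g => by
      conv_lhs => rw [← fromRows_toRows Q, fromRows_mulVec]
    -- If `Q₁ g = 0`, the form of `Q g` is minus the squared length of `Q₂ g`; it also dominates the
    -- form of `P g`, which is nonnegative. Thus `Q g = 0`, and `P g = 0` forces `g = 0`.
    have hunit : IsUnit (toRows₁ Q).det := by
      refine isUnit_det_of_mulVec_eq_zero fun g hg => ?_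
      have h1 := reForm_sigJ_nonneg_of_posSemidef hPJ g
      rw [← huQ, ← mulVec_mulVec] at h1
      have h2 := h1.trans (energy_le hqM hz hu (Q *ᵥ g) hx)
      rw [hQf, reForm_sigJ, hg] at h2
      have h3 : toRows₂ Q *ᵥ g = 0 := by
        apply lenSq_eq_zero_of_le
        have : lenSq (0 : Fin m₁ → ℂ) = 0 := lenSq_eq_zero.2 rfl
        linarith
      refine injective_mulVec_of_posDef hP ?_
      rw [← huQ, ← mulVec_mulVec, hQf, hg, h3]
      simp
    rw [graphVec_mul_inv hunit, ← hQf, mulVec_mulVec, huQ]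
    exact reForm_sigJ_nonneg_of_posSemidef hPJ _
  · intro h
    have hPf : ∀ f, (u x * graphMat w) *ᵥ f = u x *ᵥ graphVec w f := fun f => by
      rw [← mulVec_mulVec, graphMat_mulVec]
    have hP : PropertyJ (u x * graphMat w) := by
      refine ⟨PosDef.conjTranspose_mul_self _ ?_, posSemidef_of_reForm_sigJ_nonneg fun f => ?_⟩
      · intro f g hfg
        simp only [hPf] at hfg
        exact graphVec_injective w (mulVec_injective_of_isUnit
          ((Matrix.isUnit_iff_isUnit_det _).2 hdet) hfg)
      · rw [hPf]; exact h f
    refine ⟨u, fun _ => u x * graphMat w, ⟨fun i k => MeromorphicOn.const _, ?_⟩, hu,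
      fun i k => analyticAt_const, hP, ?_⟩
    · exact Eventually.of_forall fun _ => hP
    · simp only
      rw [← Matrix.mul_assoc, nonsing_inv_mul _ hdet, Matrix.one_mul, graphMat, toRows₁_fromRows,
        toRows₂_fromRows, inv_one, Matrix.mul_one]

theorem isClosed_setOf_isJNonneg (Y : BlockMat m₁ m₂) : IsClosed {w | IsJNonneg Y w} := by
  simp only [IsJNonneg, ofPred_forall]
  refine isClosed_iInter fun f => isClosed_le continuous_const ?_
  have h : Continuous fun w : Matrix (Fin m₂) (Fin m₁) ℂ => Y *ᵥ graphVec w f := by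
    refine continuous_const.matrix_mulVec (continuous_pi fun i => ?_)
    cases i with
    | inl i => exact continuous_const
    | inr i => exact (continuous_apply i).comp (continuous_id.matrix_mulVec continuous_const)
  exact Complex.continuous_re.comp (h.star.dotProduct (continuous_const.matrix_mulVec h))

theorem norm_le_one_of_isJNonneg {w : Matrix (Fin m₂) (Fin m₁) ℂ}
    (h : IsJNonneg (1 : BlockMat m₁ m₂) w) : ‖w‖ ≤ 1 := by
  rw [l2_opNorm_def]
  refine ContinuousLinearMap.opNorm_le_bound _ zero_le_one fun f => ?_
  have h1 := h f.ofLp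
  rw [one_mulVec, graphVec, reForm_sigJ, lenSq_eq_norm_sq, lenSq_eq_norm_sq] at h1
  rw [one_mul]
  exact (sq_le_sq₀ (norm_nonneg _) (norm_nonneg _)).1 (sub_nonneg.1 h1)

theorem isJNonneg_of_le (hqM : ∀ x, 0 ≤ x → ‖q x‖ ≤ M) (hz : M < z.im)
    (hu : IsFundamentalSolution (Ici 0) (fun s => coeffG z (q s)) u) {x y : ℝ} (hx : 0 ≤ x)
    (hxy : x ≤ y) {w : Matrix (Fin m₂) (Fin m₁) ℂ} (h : IsJNonneg (u y) w) :
    IsJNonneg (u x) w := fun f =>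
  (h f).trans (antitoneOn_energy hqM hz hu _ (mem_Ici.2 hx) (mem_Ici.2 (hx.trans hxy)) hxy)

theorem exists_isJNonneg (hq : ContinuousOn q (Ici 0)) (hqM : ∀ x, 0 ≤ x → ‖q x‖ ≤ M)
    (hz : M < z.im) (hu : IsFundamentalSolution (Ici 0) (fun s => coeffG z (q s)) u)
    {x : ℝ} (hx : 0 ≤ x) : ∃ w, IsJNonneg (u x) w := by
  have hP : PropertyJ (graphMat (0 : Matrix (Fin m₂) (Fin m₁) ℂ)) := by
    refine ⟨PosDef.conjTranspose_mul_self _ ?_, posSemidef_of_reForm_sigJ_nonneg fun f => ?_⟩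
    · intro f g hfg
      simp only [graphMat_mulVec] at hfg
      exact graphVec_injective 0 hfg
    · rw [graphMat_mulVec, graphVec, reForm_sigJ, zero_mulVec, lenSq_eq_zero.2 rfl, sub_zero]
      exact lenSq_nonneg f
  exact ⟨_, (mem_mobiusSet_iff hq hqM hz hu hx).1 ⟨u, fun _ => graphMat 0,
    ⟨fun i k => MeromorphicOn.const _, Eventually.of_forall fun _ => hP⟩, hu,
    fun i k => analyticAt_const, hP, rfl⟩⟩

/-- A decreasing sequence of nonempty compact sets has a common point. Integer `x` suffice by
monotonicity, and compactness comes from the unit ball at `x = 0`. -/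
theorem exists_forall_isJNonneg (hq : ContinuousOn q (Ici 0)) (hqM : ∀ x, 0 ≤ x → ‖q x‖ ≤ M)
    (hz : M < z.im) (hu : IsFundamentalSolution (Ici 0) (fun s => coeffG z (q s)) u) :
    ∃ w, ∀ x, 0 ≤ x → IsJNonneg (u x) w := by
  have h0 : IsCompact {w | IsJNonneg (u (0 : ℕ)) w} := by
    have hc : IsCompact (Metric.closedBall (0 : Matrix (Fin m₂) (Fin m₁) ℂ) 1) :=
      isCompact_closedBall 0 1
    refine hc.of_isClosed_subset (isClosed_setOf_isJNonneg _) fun w hw => ?_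
    rw [mem_ofPred_eq, Nat.cast_zero, hu.1] at hw
    rw [mem_closedBall_zero_iff]
    exact norm_le_one_of_isJNonneg hw
  obtain ⟨w, hw⟩ := IsCompact.nonempty_iInter_of_sequence_nonempty_isCompact_isClosed
    (fun k : ℕ => {w | IsJNonneg (u k) w})
    (fun k w hw => isJNonneg_of_le hqM hz hu (Nat.cast_nonneg k) (by simp) hw)
    (fun k => exists_isJNonneg hq hqM hz hu (Nat.cast_nonneg k)) h0
    (fun k => isClosed_setOf_isJNonneg _)
  refine ⟨w, fun x hx => ?_⟩
  obtain ⟨k, hk⟩ := exists_nat_ge x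
  exact isJNonneg_of_le hqM hz hu hx hk (mem_iInter.1 hw k)

/-- The difference of two graph vectors is `(0, g)`, with energy `-|g|²`. Its energy only decreases,
so its length never drops below `|g|`, and the two trajectories together keep squared length at
least `|g|²/2`. If `g ≠ 0`, the sum of their energies then decreases at least at the rate `δ |g|²`
and becomes negative. -/
theorem eq_of_forall_isJNonneg (hqM : ∀ x, 0 ≤ x → ‖q x‖ ≤ M)
    (hz : M < z.im) (hu : IsFundamentalSolution (Ici 0) (fun s => coeffG z (q s)) u)
    {w w' : Matrix (Fin m₂) (Fin m₁) ℂ} (hw : ∀ x, 0 ≤ x → IsJNonneg (u x) w)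
    (hw' : ∀ x, 0 ≤ x → IsJNonneg (u x) w') : w = w' := by
  refine sub_eq_zero.1 (ext_of_mulVec_single fun i => ?_)
  rw [zero_mulVec]
  set f : Fin m₁ → ℂ := Pi.single i 1
  set g := (w - w') *ᵥ f
  set δ := z.im - M with hδ
  have hδ0 : 0 < δ := sub_pos.2 hz
  have hlow : ∀ x, 0 ≤ x → lenSq g ≤ 2 * (lenSq (u x *ᵥ graphVec w f)
      + lenSq (u x *ᵥ graphVec w' f)) := by
    intro x hx
    refine le_trans ?_ (lenSq_sub_le _ _)
    rw [← mulVec_sub, graphVec_sub]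
    have h1 := energy_le hqM hz hu (Sum.elim 0 g) hx
    rw [reForm_sigJ, lenSq_eq_zero.2 rfl] at h1
    have h2 := reForm_sigJ_neg_le (u x *ᵥ Sum.elim 0 g)
    change lenSq g ≤ lenSq (u x *ᵥ Sum.elim 0 g)
    linarith
  set h : ℝ → ℝ := fun x => reForm (sigJ m₁ m₂) (u x *ᵥ graphVec w f)
      + reForm (sigJ m₁ m₂) (u x *ᵥ graphVec w' f) + (δ * lenSq g) * x with hh
  have hanti : AntitoneOn h (Ici 0) :=
    antitoneOn_Ici_of_hasDerivWithinAt le_rfl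
      (fun x hx => ((hasDerivWithinAt_energy hu (graphVec w f) hx).add
        (hasDerivWithinAt_energy hu (graphVec w' f) hx)).add
          ((hasDerivWithinAt_id x _).const_mul (δ * lenSq g)))
      (fun x hx => by
        have h1 := reForm_coeffG_le (z := z) (hqM x hx) (u x *ᵥ graphVec w f)
        have h2 := reForm_coeffG_le (z := z) (hqM x hx) (u x *ᵥ graphVec w' f)
        have h3 := mul_le_mul_of_nonneg_left (hlow x hx) hδ0.le
        rw [← hδ] at h1 h2
        linarith)
  apply lenSq_eq_zero_of_le
  by_contra! hpos
  have hc : 0 < δ * lenSq g := mul_pos hδ0 hpos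
  -- At this point the linear term of `h` equals `|h 0| + 1`, and nonnegative energies would make
  -- `h` exceed `h 0`.
  have hx : 0 ≤ (|h 0| + 1) / (δ * lenSq g) := by positivity
  have h1 := hanti (mem_Ici.2 le_rfl) (mem_Ici.2 hx) hx
  have h2 : (δ * lenSq g) * ((|h 0| + 1) / (δ * lenSq g)) = |h 0| + 1 := by field_simp
  have h3 := hw _ hx f
  have h4 := hw' _ hx f
  have h5 : h ((|h 0| + 1) / (δ * lenSq g)) ≥ |h 0| + 1 := by
    simp only [hh] at h2 ⊢
    linarith
  linarith [le_abs_self (h 0)]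

/-- If the length stayed above `ε` beyond `X`, the energy would decrease at a fixed rate and become
negative. Smallness at arbitrarily large points is enough later, so no limit is needed. -/
theorem exists_lenSq_le (hqM : ∀ x, 0 ≤ x → ‖q x‖ ≤ M)
    (hz : M < z.im) (hu : IsFundamentalSolution (Ici 0) (fun s => coeffG z (q s)) u)
    {w : Matrix (Fin m₂) (Fin m₁) ℂ} (hw : ∀ x, 0 ≤ x → IsJNonneg (u x) w) (f : Fin m₁ → ℂ)
    {ε X : ℝ} (hε : 0 < ε) (hX : 0 ≤ X) : ∃ x, X ≤ x ∧ lenSq (u x *ᵥ graphVec w f) ≤ ε := by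
  by_contra! hlow
  set δ := z.im - M with hδ
  have hδ0 : 0 < δ := sub_pos.2 hz
  set h : ℝ → ℝ := fun x => reForm (sigJ m₁ m₂) (u x *ᵥ graphVec w f) + (δ * ε) * x with hh
  have hanti : AntitoneOn h (Ici X) :=
    antitoneOn_Ici_of_hasDerivWithinAt hX
      (fun x hx => (hasDerivWithinAt_energy hu (graphVec w f) hx).add
          ((hasDerivWithinAt_id x _).const_mul (δ * ε)))
      (fun x hx => by
        have h1 := reForm_coeffG_le (z := z) (hqM x (hX.trans hx)) (u x *ᵥ graphVec w f)
        have h3 := mul_le_mul_of_nonneg_left (hlow x hx).le hδ0.le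
        have h4 := mul_pos hδ0 hε
        rw [← hδ] at h1
        linarith)
  have hc : 0 < δ * ε := mul_pos hδ0 hε
  set y := X + (|h X| + 1) / (δ * ε) with hy
  have hXy : X ≤ y := by
    have : 0 ≤ (|h X| + 1) / (δ * ε) := by positivity
    linarith
  have h1 := hanti (mem_Ici.2 le_rfl) (mem_Ici.2 hXy) hXy
  have h2 : (δ * ε) * y = (δ * ε) * X + (|h X| + 1) := by rw [hy]; field_simp
  have h3 := hw _ (hX.trans hXy) f
  have h4 : 0 ≤ (δ * ε) * X := by positivity
  have h5 : h y ≥ |h X| + 1 := by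
    simp only [hh] at h2 ⊢
    linarith
  linarith [le_abs_self (h X)]

theorem iInter_mobiusSet (hq : ContinuousOn q (Ici 0)) (hqM : ∀ x, 0 ≤ x → ‖q x‖ ≤ M)
    (hz : M < z.im) (hu : IsFundamentalSolution (Ici 0) (fun s => coeffG z (q s)) u) :
    ⋂ x ∈ Ici (0 : ℝ), mobiusSet M q x z = {w | ∀ x, 0 ≤ x → IsJNonneg (u x) w} := by
  ext w
  simp only [mem_iInter, mem_ofPred_eq, mem_Ici]
  exact forall₂_congr fun x hx => mem_mobiusSet_iff hq hqM hz hu hx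

theorem exists_isWeylFunction (hq : ContinuousOn q (Ici 0)) (hqM : ∀ x, 0 ≤ x → ‖q x‖ ≤ M) :
    ∃ φ, IsWeylFunction M q φ := by
  have h : ∀ z : ℂ, M < z.im → ∃ w, ⋂ x ∈ Ici (0 : ℝ), mobiusSet M q x z = {w} := by
    intro z hz
    obtain ⟨u, hu⟩ := exists_fundamentalSolution_coeffG hq z
    obtain ⟨w, hw⟩ := exists_forall_isJNonneg hq hqM hz hu
    refine ⟨w, ?_⟩
    rw [iInter_mobiusSet hq hqM hz hu]
    exact eq_singleton_iff_unique_mem.2 ⟨hw, fun w' hw' => eq_of_forall_isJNonneg hqM hz hu hw' hw⟩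
  choose! φ hφ using h
  exact ⟨φ, hφ⟩

theorem IsWeylFunction.eq_iff {φ : ℂ → Matrix (Fin m₂) (Fin m₁) ℂ} (hφ : IsWeylFunction M q φ)
    (hq : ContinuousOn q (Ici 0)) (hqM : ∀ x, 0 ≤ x → ‖q x‖ ≤ M)
    (hz : M < z.im) (hu : IsFundamentalSolution (Ici 0) (fun s => coeffG z (q s)) u)
    {w : Matrix (Fin m₂) (Fin m₁) ℂ} : φ z = w ↔ ∀ x, 0 ≤ x → IsJNonneg (u x) w := by
  have h := hφ z hz
  rw [iInter_mobiusSet hq hqM hz hu] at h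
  have h' : w ∈ {w | ∀ x, 0 ≤ x → IsJNonneg (u x) w} ↔ w ∈ ({φ z} : Set _) := by rw [h]
  rw [mem_ofPred_eq, mem_singleton_iff] at h'
  rw [h']
  exact eq_comm

end Dirac

/-- Solutions of the second auxiliary system grow at a rate that does not depend on the
derivative of the potential. -/
theorem exists_lenSq_coeffF_le (m₁ m₂ : ℕ) (z : ℂ) (M T : ℝ) : ∃ C : ℝ, 0 < C ∧
    ∀ {a : ℝ} {q p : ℝ → Matrix (Fin m₁) (Fin m₂) ℂ} {Y : ℝ → BlockMat m₁ m₂}, T ∈ Ico 0 a →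
      (∀ t ∈ Ico 0 a, ‖q t‖ ≤ M) →
      IsFundamentalSolution (Ico 0 a) (fun t => coeffF z (q t) (p t)) Y →
      ∀ f, lenSq (Y T *ᵥ f) ≤ C * lenSq f := by
  -- `C` is fixed before `q`, `p` and `Y`, so one bound serves the systems at all `x`
  -- simultaneously.
  obtain ⟨C, hC0, hC⟩ := exists_reForm_coeffF_le m₁ m₂ z M
  refine ⟨Real.exp (C * T), Real.exp_pos _, fun {a q p Y} hT hq hY f => ?_⟩
  have hTa : Icc 0 T ⊆ Ico 0 a := fun s hs => ⟨hs.1, hs.2.trans_lt hT.2⟩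
  have hd : ∀ t ∈ Icc 0 T, HasDerivWithinAt (fun t => Real.exp (-(C * t)) * lenSq (Y t *ᵥ f))
      (Real.exp (-(C * t)) * (reForm ((coeffF z (q t) (p t))ᴴ * 1 + 1 * coeffF z (q t) (p t))
        (Y t *ᵥ f) - C * lenSq (Y t *ᵥ f))) (Icc 0 T) t := by
    intro t ht
    have h1 := HasDerivWithinAt.reForm (A := fun t => coeffF z (q t) (p t))
      ((hY.2 t (hTa ht)).mono hTa) 1 f
    simp only [reForm_one] at h1
    have h2 : HasDerivAt (fun t : ℝ => -(C * t)) (-(C * 1)) t :=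
      ((hasDerivAt_id t).const_mul C).neg
    refine (h2.exp.hasDerivWithinAt.mul h1).congr_deriv ?_
    ring
  have hanti := antitoneOn_of_hasDerivWithinAt_nonpos (convex_Icc 0 T)
    (fun t ht => (hd t ht).continuousWithinAt)
    (fun t ht => (hd t (interior_subset ht)).mono interior_subset)
    (fun t ht => mul_nonpos_of_nonneg_of_nonpos (Real.exp_pos _).le
      (sub_nonpos.2 (hC _ _ (hq t (hTa (interior_subset ht))) _)))
    ⟨le_rfl, hT.1⟩ ⟨hT.1, le_rfl⟩ hT.1
  simp only [hY.1, mul_zero, neg_zero, Real.exp_zero, one_mul, one_mulVec] at hanti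
  calc lenSq (Y T *ᵥ f)
      = Real.exp (C * T) * (Real.exp (-(C * T)) * lenSq (Y T *ᵥ f)) := by
        rw [← mul_assoc, ← Real.exp_add]; simp
    _ ≤ Real.exp (C * T) * lenSq f := by gcongr

theorem mulVec_graphVec (R : BlockMat m₁ m₂) (w : Matrix (Fin m₂) (Fin m₁) ℂ) (f : Fin m₁ → ℂ) :
    R *ᵥ graphVec w f = Sum.elim ((R.toBlocks₁₁ + R.toBlocks₁₂ * w) *ᵥ f)
      ((R.toBlocks₂₁ + R.toBlocks₂₂ * w) *ᵥ f) := by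
  conv_lhs => rw [← fromBlocks_toBlocks R]
  rw [fromBlocks_mulVec]
  simp [graphVec, add_mulVec, mulVec_mulVec, Function.comp_def]

end FocusingNLS

/-! ### Evolution of the Weyl function. -/

theorem mainTheorem5 (m₁ m₂ : ℕ) (a M : ℝ) (ha : 0 < a) (hM : 0 < M)
    (v : ℝ → ℝ → Matrix (Fin m₁) (Fin m₂) ℂ)
    (hv : ContDiffOn ℝ 1 (fun p : ℝ × ℝ => v p.1 p.2) (FocusingNLS.semiStrip a))
    (hvxx : ∀ x t : ℝ, (x, t) ∈ FocusingNLS.semiStrip a →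
      DifferentiableWithinAt ℝ (fun s => FocusingNLS.partialX v s t) (Set.Ici 0) x)
    (hNLS : ∀ x t : ℝ, (x, t) ∈ FocusingNLS.semiStrip a →
      (2 : ℂ) • FocusingNLS.partialT a v x t
        + Complex.I • (FocusingNLS.partialX (FocusingNLS.partialX v) x t
            + (2 : ℂ) • (v x t * (v x t)ᴴ * v x t)) = 0)
    (hbound : ∀ x t : ℝ, (x, t) ∈ FocusingNLS.semiStrip a → ‖v x t‖ ≤ M)
    (hvxbound : ∀ t ∈ Set.Ico 0 a, ∃ C : ℝ, ∀ x : ℝ, 0 < x → ‖FocusingNLS.partialX v x t‖ ≤ C) :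
    -- the Weyl functions `φ(t, z)` and the fundamental solution `R(t, z)` exist
    (∃ φ : ℝ → ℂ → Matrix (Fin m₂) (Fin m₁) ℂ, ∀ t ∈ Set.Ico 0 a,
      FocusingNLS.IsWeylFunction M (fun x => v x t) (φ t)) ∧
    (∃ R : ℝ → ℂ → FocusingNLS.BlockMat m₁ m₂, ∀ z : ℂ,
      FocusingNLS.IsFundamentalSolution (Set.Ico 0 a)
        (fun t => FocusingNLS.coeffF z (v 0 t) (FocusingNLS.partialX v 0 t)) (fun t => R t z)) ∧
    -- and the evolution is given by the linear fractional transformation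
    (∀ (φ : ℝ → ℂ → Matrix (Fin m₂) (Fin m₁) ℂ) (R : ℝ → ℂ → FocusingNLS.BlockMat m₁ m₂),
      (∀ t ∈ Set.Ico 0 a, FocusingNLS.IsWeylFunction M (fun x => v x t) (φ t)) →
      (∀ z : ℂ, FocusingNLS.IsFundamentalSolution (Set.Ico 0 a)
        (fun t => FocusingNLS.coeffF z (v 0 t) (FocusingNLS.partialX v 0 t)) (fun t => R t z)) →
      ∀ t ∈ Set.Ico 0 a, ∀ z : ℂ, M < z.im →
        IsUnit ((R t z).toBlocks₁₁ + (R t z).toBlocks₁₂ * φ 0 z).det ∧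
        φ t z = ((R t z).toBlocks₂₁ + (R t z).toBlocks₂₂ * φ 0 z)
          * ((R t z).toBlocks₁₁ + (R t z).toBlocks₁₂ * φ 0 z)⁻¹) := by
  open FocusingNLS in
  have h0a : (0 : ℝ) ∈ Ico 0 a := ⟨le_rfl, ha⟩
  have hqc : ∀ t ∈ Ico 0 a, ContinuousOn (fun x => v x t) (Ici 0) := fun t ht =>
    hv.continuousOn.comp (f := fun x : ℝ => (x, t)) (Continuous.prodMk_left t).continuousOn
      fun x hx => ⟨hx, ht⟩
  have hqM : ∀ t ∈ Ico 0 a, ∀ x, 0 ≤ x → ‖v x t‖ ≤ M := fun t ht x hx => hbound x t ⟨hx, ht⟩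
  have hFc : ∀ x ∈ Ici (0 : ℝ), ∀ z : ℂ,
      ContinuousOn (fun t => coeffF z (v x t) (partialX v x t)) (Ico 0 a) := by
    intro x hx z
    have hslice : MapsTo (fun t : ℝ => (x, t)) (Ico 0 a) (semiStrip a) := fun t ht => ⟨hx, ht⟩
    have hpair : ContinuousOn (fun t : ℝ => (x, t)) (Ico 0 a) :=
      (Continuous.prodMk_right x).continuousOn
    exact continuousOn_coeffF z (q := fun t => v x t) (p := fun t => partialX v x t)
      (hv.continuousOn.comp (f := fun t : ℝ => (x, t)) hpair hslice)
      ((continuousOn_partialX hv).comp (f := fun t : ℝ => (x, t)) hpair hslice)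
  have hRex : ∀ x ∈ Ici (0 : ℝ), ∀ z : ℂ, ∃ Y : ℝ → BlockMat m₁ m₂,
      IsFundamentalSolution (Ico 0 a) (fun t => coeffF z (v x t) (partialX v x t)) Y :=
    fun x hx z => exists_linearODE_Ico ha (hFc x hx z)
  refine ⟨?_, ?_, ?_⟩
  · have h : ∀ t ∈ Ico 0 a, ∃ φ, IsWeylFunction M (fun x => v x t) φ := fun t ht =>
      exists_isWeylFunction (hqc t ht) (hqM t ht)
    choose! φ hφ using h
    exact ⟨φ, hφ⟩
  · choose Y hY using hRex 0 (mem_Ici.2 le_rfl)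
    exact ⟨fun t z => Y z t, hY⟩
  · intro φ R hφ hR t ht z hz
    obtain ⟨u₀, hu₀⟩ := exists_fundamentalSolution_coeffG (hqc 0 h0a) z
    obtain ⟨u, hu⟩ := exists_fundamentalSolution_coeffG (hqc t ht) z
    have hw₀ := ((hφ 0 h0a).eq_iff (hqc 0 h0a) (hqM 0 h0a) hz hu₀).1 rfl
    set w := φ 0 z
    have hRex' : ∀ x : ℝ, ∃ Y : ℝ → BlockMat m₁ m₂, x ∈ Ici (0 : ℝ) →
        IsFundamentalSolution (Ico 0 a) (fun t => coeffF z (v x t) (partialX v x t)) Y ∧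
          Y t * u₀ x = u x * R t z := by
      classical
      choose! Y hY using fun x (hx : x ∈ Ici (0 : ℝ)) => hRex x hx z
      -- The chosen solutions are replaced at `x = 0` by the given `R`, so that the factorization
      -- contains exactly `R t z`.
      set Y' := Function.update Y 0 (fun s => R s z) with hY'
      have hY'sol : ∀ x ∈ Ici (0 : ℝ), IsFundamentalSolution (Ico 0 a)
          (fun t => coeffF z (v x t) (partialX v x t)) (Y' x) := by
        intro x hx
        by_cases h : x = 0
        · subst h; rw [hY', Function.update_self]; exact hR z
        · rw [hY', Function.update_of_ne h]; exact hY x hx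
      intro x
      refine ⟨Y' x, fun hx => ⟨hY'sol x hx, ?_⟩⟩
      have := fundamentalSolution_factorization hv hvxx hNLS hY'sol ht hu₀ hu hx
      rwa [hY', Function.update_self, ← hY'] at this
    choose Y hY using hRex'
    obtain ⟨C, hC0, hC⟩ := exists_lenSq_coeffF_le m₁ m₂ z M t
    -- The graph of `φ 0 z`, transported by `R t z`, stays `j`-nonnegative for the system at time
    -- `t`.
    have henergy : ∀ x, 0 ≤ x → ∀ f,
        0 ≤ reForm (sigJ m₁ m₂) (u x *ᵥ (R t z *ᵥ graphVec w f)) := by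
      intro x hx f
      refine le_of_forall_pos_le_add fun ε hε => ?_
      -- With `ε / C` at time 0, the factor `C` for `R(y,t)` leaves squared length at most `ε` at
      -- time `t`.
      obtain ⟨y, hxy, hy⟩ := exists_lenSq_le (hqM 0 h0a) hz hu₀ hw₀ f (div_pos hε hC0) hx
      have hy0 := hx.trans hxy
      have h1 := antitoneOn_energy (hqM t ht) hz hu (R t z *ᵥ graphVec w f) (mem_Ici.2 hx)
        (mem_Ici.2 hy0) hxy
      have h2 := reForm_sigJ_neg_le (u y *ᵥ (R t z *ᵥ graphVec w f))
      have h3 := hC ht (fun s hs => hbound y s ⟨hy0, hs⟩) (hY y hy0).1 (u₀ y *ᵥ graphVec w f)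
      rw [mulVec_mulVec, (hY y hy0).2, ← mulVec_mulVec] at h3
      have h4 : C * lenSq (u₀ y *ᵥ graphVec w f) ≤ ε := by
        calc _ ≤ C * (ε / C) := by gcongr
          _ = ε := by field_simp
      simp only at h1
      linarith
    have hRdet : IsUnit (R t z).det := (hR z).isUnit_det (hFc 0 (mem_Ici.2 le_rfl) z) ht.1
      fun s hs => ⟨hs.1, hs.2.trans_lt ht.2⟩
    -- At `x = 0` a transported vector with zero upper block has nonnegative form only if its lower
    -- block vanishes too; invertibility of `R t z` then gives `f = 0`.
    have hunit : IsUnit ((R t z).toBlocks₁₁ + (R t z).toBlocks₁₂ * w).det := by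
      refine isUnit_det_of_mulVec_eq_zero fun f hf => ?_
      have h1 := henergy 0 le_rfl f
      rw [hu.1, one_mulVec, mulVec_graphVec, reForm_sigJ, hf, lenSq_eq_zero.2 rfl] at h1
      have h2 := lenSq_eq_zero_of_le (by linarith :
        lenSq (((R t z).toBlocks₂₁ + (R t z).toBlocks₂₂ * w) *ᵥ f) ≤ 0)
      have h3 : R t z *ᵥ graphVec w f = R t z *ᵥ graphVec w 0 := by
        rw [mulVec_graphVec, mulVec_graphVec, hf, h2, mulVec_zero, mulVec_zero]
      exact graphVec_injective w (mulVec_injective_of_isUnit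
        ((Matrix.isUnit_iff_isUnit_det _).2 hRdet) h3)
    refine ⟨hunit, ((hφ t ht).eq_iff (hqc t ht) (hqM t ht) hz hu).2 fun x hx f => ?_⟩
    -- Each vector in the graph of the transformed matrix is the image under `R t z` of a vector in
    -- the graph of `φ 0 z`.
    rw [graphVec_mul_inv hunit, ← mulVec_graphVec]
    exact henergy x hx _
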